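/- Let $\mathfrak g$ be a finite-dimensional real Lie algebra (for example the Lie algebra of a Lie group $G$) with a basis $(e_a)$ and structure constants $[e_b,e_c]=C_{bc}{}^a e_a$ (repeated indices are summed), and fix $R=R^a e_a\in\mathfrak g$ and real constants $v_t,v_x,v_y$. Let $g_{ab}$ be a positive definite symmetric tensor and $p_{ab}$ a skew tensor on $\mathfrak g$, both invariant under the adjoint action of the one-parameter subgroup generated by $R$ in the sense that $$g_{ae}C_{bc}{}^eR^c=-g_{be}C_{ac}{}^eR^c,\qquad p_{ae}C_{bc}{}^eR^c=p_{be}C_{ac}{}^eR^c .$$ Put $C^a{}_{bc}=g^{ad}C_{db}{}^e g_{ec}$ and $Q^a{}_{bc}=-\tfrac32\, g^{ad}p_{e[d}C_{bc]}{}^e$, where $g^{ad}$ is the inverse of $g_{ad}$ and $[dbc]$ denotes total antisymmetrization with weight $1/3!$. Write $E^2=g_{ab}E^aE^b$. Call a real constant $\lambda$ small if there is $k>0$ such that for all $E,H\in\mathfrak g$ $$\tfrac1k(E^2+H^2)\le E^2+H^2+2\lambda v_tH^aE^bp_{ab}\le k(E^2+H^2).$$ Let $\Sigma$ be $\mathbb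 R$ or a circle $S^1$ of any circumference, with coordinate $x$ (functions on $S^1$ being periodic functions of $x$), and let $s=1$ or $s=-1$. Then there is $\lambda_0>0$, depending only on $g,p,v_t$, such that every $\lambda$ with $|\lambda|<\lambda_0$ is small. Moreover, for every small $\lambda$, every $t_0\in\mathbb R$ and all smooth compactly supported initial data $\hat E,\hat H,\hat B:\Sigma\to\mathfrak g$ (compact support is no condition on $S^1$) satisfying the constraint $\partial_x\hat H^a=-C_{bc}{}^a\hat E^b(\hat H^c-R^c)$, there is exactly one triple of smooth functions $E,H,B:\Sigma\times\mathbb R\to\mathfrak g$ of $(x,t)$ that satisfies $$\partial_xH^a=-C_{bc}{}^aE^b(H^c-R^c),$$ $$\partial_tE^a=\partial_xB^a-C_{bc}{}^aB^bE^c,$$ $$\partial_tH^a=-C_{bc}{}^aB^b(H^c-R^c),$$ $$\partial_tB^a=\partial_xE^a+s\,C_{bc}{}^aH^bR^c-C^a{}_{bc}(B^bB^c-E^bE^c-H^bH^c)-\lambda Q^a{}_{bc}(v_yB^bE^c-v_xB^bH^c+v_tE^bH^c)$$ for all $x\in\Sigma$, $t\in\mathbb R$, together with $E(x,t_0)=\hat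 E(x)$, $H(x,t_0)=\hat H(x)$, $B(x,t_0)=\hat B(x)$ for all $x\in\Sigma$. -/

import Mathlib

open scoped ContDiff

/-- The structure constants `C_{bc}{}^a` of a real Lie algebra in the basis `e`:
`[e_b, e_c] = C_{bc}{}^a e_a`, written `structureConst e b c a`. -/
noncomputable def structureConst {𝔤 ι : Type*} [LieRing 𝔤] [LieAlgebra ℝ 𝔤]
    (e : Module.Basis ι ℝ 𝔤) (b c a : ι) : ℝ :=
  e.repr ⁅e b, e c⁆ a

/-- `commC C X Y` is the vector `C_{bc}{}^a X^b Y^c`, i.e. the commutator `[X, Y]`. -/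
noncomputable def commC {ι : Type*} [Fintype ι] (C : ι → ι → ι → ℝ) (X Y : ι → ℝ) : ι → ℝ :=
  fun a => ∑ b, ∑ c, C b c a * X b * Y c

/-- The tensor `C^a{}_{bc} = g^{ad} C_{db}{}^e g_{ec}`. -/
noncomputable def raisedC {ι : Type*} [Fintype ι] [DecidableEq ι] (C : ι → ι → ι → ℝ)
    (g : Matrix ι ι ℝ) (a b c : ι) : ℝ :=
  ∑ d, ∑ e, g⁻¹ a d * C d b e * g e c

/-- Total antisymmetrization `T_{[dbc]}`, with the normalizing factor `1 / 3!`. -/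
noncomputable def antisymm₃ {ι : Type*} (T : ι → ι → ι → ℝ) (d b c : ι) : ℝ :=
  (1 / 6 : ℝ) * (T d b c + T b c d + T c d b - T b d c - T d c b - T c b d)

/-- The torsion tensor `Q^a{}_{bc} = -(3/2) g^{ad} p_{e[d} C_{bc]}{}^e`. -/
noncomputable def torsionQ {ι : Type*} [Fintype ι] [DecidableEq ι] (C : ι → ι → ι → ℝ)
    (g p : Matrix ι ι ℝ) (a b c : ι) : ℝ :=
  -(3 / 2 : ℝ) * ∑ d, g⁻¹ a d * antisymm₃ (fun d b c => ∑ e, p e d * C b c e) d b c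

/-- `T^a{}_{bc} X^b Y^c` for a tensor `T` with components `T a b c`. -/
noncomputable def contract {ι : Type*} [Fintype ι] (T : ι → ι → ι → ℝ) (X Y : ι → ℝ) : ι → ℝ :=
  fun a => ∑ b, ∑ c, T a b c * X b * Y c

/-- `m_{ab} X^a Y^b`. -/
noncomputable def pairing {ι : Type*} [Fintype ι] (m : Matrix ι ι ℝ) (X Y : ι → ℝ) : ℝ :=
  ∑ a, ∑ b, m a b * X a * Y b

/-- Invariance of the metric under the adjoint action of the subgroup generated by `R`:
`g_{ae} C_{bc}{}^e R^c = - g_{be} C_{ac}{}^e R^c`. -/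
def MetricInvariant {ι : Type*} [Fintype ι] (C : ι → ι → ι → ℝ) (g : Matrix ι ι ℝ)
    (R : ι → ℝ) : Prop :=
  ∀ a b, ∑ e, ∑ c, g a e * C b c e * R c = -∑ e, ∑ c, g b e * C a c e * R c

/-- Invariance of the skew tensor under the adjoint action of the subgroup generated by `R`:
`p_{ae} C_{bc}{}^e R^c = p_{be} C_{ac}{}^e R^c`. -/
def SkewInvariant {ι : Type*} [Fintype ι] (C : ι → ι → ι → ℝ) (p : Matrix ι ι ℝ)
    (R : ι → ℝ) : Prop :=
  ∀ a b, ∑ e, ∑ c, p a e * C b c e * R c = ∑ e, ∑ c, p b e * C a c e * R c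

/-- The coupling constant `lam` is small (relative to `g`, `p`, `v_t`): for some `k > 0`,
`k⁻¹ (E² + H²) ≤ E² + H² + 2 lam v_t H^a E^b p_{ab} ≤ k (E² + H²)` for all vectors `E`, `H`,
where `E² = g_{ab} E^a E^b`. -/
def IsSmallCoupling {ι : Type*} [Fintype ι] (g p : Matrix ι ι ℝ) (vt lam : ℝ) : Prop :=
  ∃ k : ℝ, 0 < k ∧ ∀ E H : ι → ℝ,
    (1 / k) * (pairing g E E + pairing g H H) ≤
        pairing g E E + pairing g H H + 2 * lam * vt * pairing p H E ∧
      pairing g E E + pairing g H H + 2 * lam * vt * pairing p H E ≤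
        k * (pairing g E E + pairing g H H)

/-- The spatial manifold `Σ`: the line, or a circle of circumference `L > 0`. -/
inductive Space : Type where
  | line : Space
  | circle (L : ℝ) (hL : 0 < L) : Space

/-- A function of `x ∈ ℝ` is a function on `Σ`: on a circle this means `L`-periodicity. -/
def Space.IsFunctionOn {V : Type*} : Space → (ℝ → V) → Prop
  | .line, _ => True
  | .circle L _, f => Function.Periodic f L

/-- A function on `Σ` has compact support: on the circle this is no condition. -/
def Space.CompactlySupported {V : Type*} [Zero V] : Space → (ℝ → V) → Prop
  | .line, f => HasCompactSupport f
  | .circle _ _, _ => True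

/-- A smooth compactly supported vector-valued function on `Σ`. -/
structure Space.IsSmoothDatum {ι : Type*} [Fintype ι] (S : Space) (f : ℝ → ι → ℝ) : Prop where
  isFunctionOn : S.IsFunctionOn f
  smooth : ContDiff ℝ ∞ f
  compactlySupported : S.CompactlySupported f

/-- A smooth vector-valued function of `(x, t) ∈ Σ × ℝ`. -/
structure Space.IsSmoothField {ι : Type*} [Fintype ι] (S : Space) (F : ℝ → ℝ → ι → ℝ) :
    Prop where
  isFunctionOn : ∀ t, S.IsFunctionOn (fun x => F x t)
  smooth : ContDiff ℝ ∞ (fun z : ℝ × ℝ => F z.1 z.2)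

/-- The unknowns `E^a(x,t)`, `H^a(x,t)`, `B^a(x,t)`. -/
@[ext] structure FrameFields (ι : Type*) where
  E : ℝ → ℝ → ι → ℝ
  H : ℝ → ℝ → ι → ℝ
  B : ℝ → ℝ → ι → ℝ

/-- The constraint `∂_x H^a = - C_{bc}{}^a E^b (H^c - R^c)` at one time. -/
def SatisfiesConstraint {ι : Type*} [Fintype ι] (C : ι → ι → ι → ℝ) (R : ι → ℝ)
    (E H : ℝ → ι → ℝ) : Prop :=
  ∀ x a, deriv (fun x' => H x' a) x = -commC C (E x) (H x - R) a

/-- The reduced `1+1` system, at all `(x, t)`. The number `s` is the coefficient of the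
commutator term `C_{bc}{}^a H^b R^c` in the equation for `B`. -/
structure SolvesReducedSystem {ι : Type*} [Fintype ι] [DecidableEq ι] (C : ι → ι → ι → ℝ)
    (g p : Matrix ι ι ℝ) (R : ι → ℝ) (vt vx vy lam s : ℝ) (u : FrameFields ι) : Prop where
  constraint : ∀ t, SatisfiesConstraint C R (fun x => u.E x t) (fun x => u.H x t)
  evolution_E : ∀ x t a,
    deriv (fun t' => u.E x t' a) t =
      deriv (fun x' => u.B x' t a) x - commC C (u.B x t) (u.E x t) a
  evolution_H : ∀ x t a,
    deriv (fun t' => u.H x t' a) t = -commC C (u.B x t) (u.H x t - R) a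
  evolution_B : ∀ x t a,
    deriv (fun t' => u.B x t' a) t =
      deriv (fun x' => u.E x' t a) x + s * commC C (u.H x t) R a
        - (contract (raisedC C g) (u.B x t) (u.B x t) a
            - contract (raisedC C g) (u.E x t) (u.E x t) a
            - contract (raisedC C g) (u.H x t) (u.H x t) a)
        - lam * (vy * contract (torsionQ C g p) (u.B x t) (u.E x t) a
            - vx * contract (torsionQ C g p) (u.B x t) (u.H x t) a
            + vt * contract (torsionQ C g p) (u.E x t) (u.H x t) a)

/-- Smooth global solution on `Σ × ℝ` of the Cauchy problem with data `E₀, H₀, B₀` at time `t₀`. -/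
structure IsGlobalSolution {ι : Type*} [Fintype ι] [DecidableEq ι] (S : Space)
    (C : ι → ι → ι → ℝ) (g p : Matrix ι ι ℝ) (R : ι → ℝ) (vt vx vy lam s t₀ : ℝ)
    (E₀ H₀ B₀ : ℝ → ι → ℝ) (u : FrameFields ι) : Prop where
  smooth_E : S.IsSmoothField u.E
  smooth_H : S.IsSmoothField u.H
  smooth_B : S.IsSmoothField u.B
  solves : SolvesReducedSystem C g p R vt vx vy lam s u
  initial_E : ∀ x, u.E x t₀ = E₀ x
  initial_H : ∀ x, u.H x t₀ = H₀ x
  initial_B : ∀ x, u.B x t₀ = B₀ x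

/-! To first order the system is diagonal in E + B, E - B and H, with characteristic speeds 1, -1
and 0, and its nonlinearity is quadratic. Such a system has finite propagation speed and is uniquely
solvable on double cones as long as the solution stays bounded. Global existence therefore reduces
to an a priori bound on a cone in terms of the data there.

The bound rests on three algebraic facts. (1) `energy_identity`: the density e = (B² + E² + H²)/2 +
μ p(H,E) with μ = -λ vₜ/2 obeys ∂ₜe = ∂ₓf + (s-1) g(B,[H,R]). The constraint, the invariance of g
and p under R, and the choice of μ make every cubic term cancel; for s = -1 the remaining term is
quadratic and costs only an exponential factor. (2) `le_energy_sub_flux`: for small λ, e - f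
dominates (E-B)² + H², and e + f is nonnegative. Integrating (1) over a backward triangle
(`integral_flux_le`) bounds the integral of (E-B)² + H² along the side which carries E + B. (3)
`null_identity`: along that side, with X = E + B, the derivative of g(X,X) contains the factor X
and, besides it, only terms linear in H, quadratic in H, or of the form (E-B)H. By (2) the
coefficients are integrable, and Gronwall's inequality bounds X pointwise.

Reflections of x and t map the system to itself with other signs of the constants v, so (3) also
bounds E - B, and both for negative times. Finally H - R solves a linear ODE driven by B.

For existence, the nonlinearity is cut off outside a ball larger than the a priori bound allows. The
truncated system has a global mild solution by Picard iteration (`exists_mild`), smooth by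
`contDiff_of_mild`, and a continuity argument shows that on the cone the cutoff is never reached
(`exists_solution_on_doubleCone`). Uniqueness glues the cones together, and uniqueness applied to
translates gives periodicity on the circle. -/

section

open Set Filter
open scoped Topology

/-! ### Mild solutions of semilinear transport systems on double cones -/

section Transport

variable {Y W κ : Type*} [NormedAddCommGroup Y] [NormedSpace ℝ Y]
  [NormedAddCommGroup W] [NormedSpace ℝ W]

/-- Duhamel's operator of the transport system `∂ₜ uⱼ = cⱼ · ∂_y uⱼ + Gⱼ(y, t, u)`, `u(0) = u₀`.
Its fixed points are the mild solutions. -/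
noncomputable def duhamel (c : κ → Y) (G : Y → ℝ → (κ → W) → κ → W) (u₀ : Y → κ → W)
    (u : Y → ℝ → κ → W) (y : Y) (t : ℝ) : κ → W := fun j =>
  u₀ (y + t • c j) j + t • ∫ θ in (0 : ℝ)..1,
    G (y + (t * (1 - θ)) • c j) (t * θ) (u (y + (t * (1 - θ)) • c j) (t * θ)) j

/-- The double cone with vertices at times `± R / C` over the ball of radius `R`. -/
def doubleCone (Y : Type*) [NormedAddCommGroup Y] (C R : ℝ) : Set (Y × ℝ) :=
  {z | ‖z.1‖ + C * |z.2| ≤ R}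

/-- Moving from time t to tθ displaces y by at most C|t|(1-θ), which is exactly what the cone gains
in width. Hence Duhamel's formula at a point of the cone uses only values inside it. -/
theorem mem_doubleCone_of_characteristic {C R : ℝ} {c : Y} (hc : ‖c‖ ≤ C) {y : Y}
    {t θ : ℝ} (h : (y, t) ∈ doubleCone Y C R) (hθ : θ ∈ Icc (0 : ℝ) 1) :
    (y + (t * (1 - θ)) • c, t * θ) ∈ doubleCone Y C R := by
  simp only [doubleCone, mem_ofPred_eq] at h ⊢
  have h1 : ‖y + (t * (1 - θ)) • c‖ ≤ ‖y‖ + |t| * (1 - θ) * C := by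
    refine (norm_add_le _ _).trans ?_
    rw [norm_smul, Real.norm_eq_abs, abs_mul, abs_of_nonneg (sub_nonneg.2 hθ.2)]
    have := mul_nonneg (abs_nonneg t) (sub_nonneg.2 hθ.2)
    gcongr
  rw [abs_mul, abs_of_nonneg hθ.1]
  linarith

theorem isCompact_doubleCone [FiniteDimensional ℝ Y] {C R : ℝ} (hC : 0 < C) :
    IsCompact (doubleCone Y C R) := by
  have : ProperSpace Y := FiniteDimensional.proper ℝ Y
  refine Metric.isCompact_of_isClosed_isBounded
    (isClosed_le (by fun_prop) continuous_const) ?_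
  refine (Metric.isBounded_closedBall (x := (0 : Y × ℝ)) (r := max R (R / C))).subset ?_
  rintro ⟨y, t⟩ h
  simp only [doubleCone, mem_ofPred_eq] at h
  rw [mem_closedBall_zero_iff, Prod.norm_def]
  have := norm_nonneg y
  have h2 := mul_nonneg hC.le (abs_nonneg t)
  refine max_le_max (by linarith) ?_
  rw [Real.norm_eq_abs, le_div_iff₀ hC]
  linarith

omit [NormedSpace ℝ Y] in
theorem mem_doubleCone_self {C : ℝ} (y : Y) (t : ℝ) :
    (y, t) ∈ doubleCone Y C (‖y‖ + C * |t|) := by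
  simp [doubleCone]

variable {c : κ → Y} {G : Y → ℝ → (κ → W) → κ → W} {u₀ : Y → κ → W}

omit [NormedSpace ℝ W] in
theorem continuous_duhamel_integrand (hG : Continuous fun z : Y × ℝ × (κ → W) => G z.1 z.2.1 z.2.2)
    {u : Y → ℝ → κ → W} (hu : Continuous fun z : Y × ℝ => u z.1 z.2) (j : κ) :
    Continuous fun q : (Y × ℝ) × ℝ =>
      G (q.1.1 + (q.1.2 * (1 - q.2)) • c j) (q.1.2 * q.2)
        (u (q.1.1 + (q.1.2 * (1 - q.2)) • c j) (q.1.2 * q.2)) j := by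
  have h1 : Continuous fun q : (Y × ℝ) × ℝ =>
      (q.1.1 + (q.1.2 * (1 - q.2)) • c j, q.1.2 * q.2) := by fun_prop
  have h2 := hu.comp h1
  have h3 := hG.comp (h1.fst.prodMk (h1.snd.prodMk h2))
  exact (continuous_apply j).comp h3

theorem continuous_duhamel (hG : Continuous fun z : Y × ℝ × (κ → W) => G z.1 z.2.1 z.2.2)
    (hu₀ : Continuous u₀) {u : Y → ℝ → κ → W} (hu : Continuous fun z : Y × ℝ => u z.1 z.2) :
    Continuous fun z : Y × ℝ => duhamel c G u₀ u z.1 z.2 := by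
  refine continuous_pi fun j => ?_
  have h1 : Continuous fun z : Y × ℝ => u₀ (z.1 + z.2 • c j) j :=
    (continuous_apply j).comp (hu₀.comp (by fun_prop))
  have h2 := intervalIntegral.continuous_parametric_intervalIntegral_of_continuous'
    (f := fun (z : Y × ℝ) (θ : ℝ) => G (z.1 + (z.2 * (1 - θ)) • c j) (z.2 * θ)
        (u (z.1 + (z.2 * (1 - θ)) • c j) (z.2 * θ)) j) (μ := MeasureTheory.volume)
    (continuous_duhamel_integrand hG hu j) 0 1
  exact h1.add (continuous_snd.smul h2)

variable [Fintype κ]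

/-- One Picard step integrates θ^m over the unit interval, which gains the factor 1/(m+1). The
factorials make the iteration converge on cones of every size, without smallness of time. -/
theorem norm_duhamel_sub_le {C R L M : ℝ} (hL : 0 ≤ L) (hM : 0 ≤ M)
    (hc : ∀ j, ‖c j‖ ≤ C) (hG : Continuous fun z : Y × ℝ × (κ → W) => G z.1 z.2.1 z.2.2)
    {u v : Y → ℝ → κ → W} (hu : Continuous fun z : Y × ℝ => u z.1 z.2)
    (hv : Continuous fun z : Y × ℝ => v z.1 z.2)
    (hLip : ∀ y t, (y, t) ∈ doubleCone Y C R →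
      ‖G y t (u y t) - G y t (v y t)‖ ≤ L * ‖u y t - v y t‖)
    (m : ℕ) (huv : ∀ y t, (y, t) ∈ doubleCone Y C R →
      ‖u y t - v y t‖ ≤ M * ((L * |t|) ^ m / m.factorial)) (y : Y) (t : ℝ)
    (h : (y, t) ∈ doubleCone Y C R) :
    ‖duhamel c G u₀ u y t - duhamel c G u₀ v y t‖ ≤
      M * ((L * |t|) ^ (m + 1) / (m + 1).factorial) := by
  rw [pi_norm_le_iff_of_nonneg (by positivity)]
  intro j
  have cu : Continuous fun θ : ℝ => G (y + (t * (1 - θ)) • c j) (t * θ)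
      (u (y + (t * (1 - θ)) • c j) (t * θ)) j :=
    (continuous_duhamel_integrand (c := c) hG hu j).comp (Continuous.prodMk_right (y, t))
  have cv : Continuous fun θ : ℝ => G (y + (t * (1 - θ)) • c j) (t * θ)
      (v (y + (t * (1 - θ)) • c j) (t * θ)) j :=
    (continuous_duhamel_integrand (c := c) hG hv j).comp (Continuous.prodMk_right (y, t))
  have key : ‖∫ θ in (0 : ℝ)..1, (G (y + (t * (1 - θ)) • c j) (t * θ)
      (u (y + (t * (1 - θ)) • c j) (t * θ)) j - G (y + (t * (1 - θ)) • c j) (t * θ)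
      (v (y + (t * (1 - θ)) • c j) (t * θ)) j)‖ ≤
      ∫ θ in (0 : ℝ)..1, (L * M * (L * |t|) ^ m / m.factorial) * θ ^ m := by
    refine intervalIntegral.norm_integral_le_of_norm_le zero_le_one ?_
      (Continuous.intervalIntegrable (by fun_prop) _ _)
    refine Filter.Eventually.of_forall fun θ hθ => ?_
    have hθ' : θ ∈ Icc (0 : ℝ) 1 := ⟨hθ.1.le, hθ.2⟩
    have hmem := mem_doubleCone_of_characteristic (hc j) h hθ'
    rw [← Pi.sub_apply]
    refine (norm_le_pi_norm _ j).trans ((hLip _ _ hmem).trans ?_)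
    refine (mul_le_mul_of_nonneg_left (huv _ _ hmem) hL).trans (le_of_eq ?_)
    rw [abs_mul, abs_of_nonneg hθ'.1]
    ring
  have e : (duhamel c G u₀ u y t - duhamel c G u₀ v y t) j =
      t • ∫ θ in (0 : ℝ)..1, (G (y + (t * (1 - θ)) • c j) (t * θ)
      (u (y + (t * (1 - θ)) • c j) (t * θ)) j - G (y + (t * (1 - θ)) • c j) (t * θ)
      (v (y + (t * (1 - θ)) • c j) (t * θ)) j) := by
    rw [intervalIntegral.integral_sub (cu.intervalIntegrable _ _) (cv.intervalIntegrable _ _)]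
    simp only [duhamel, Pi.sub_apply, smul_sub]
    abel
  rw [e, norm_smul, Real.norm_eq_abs]
  refine (mul_le_mul_of_nonneg_left key (abs_nonneg t)).trans (le_of_eq ?_)
  rw [intervalIntegral.integral_const_mul, integral_pow, Nat.factorial_succ]
  push_cast
  have : (m.factorial : ℝ) ≠ 0 := by positivity
  field_simp
  ring

/-- Uniqueness of mild solutions on a double cone. -/
theorem eqOn_doubleCone_of_mild [FiniteDimensional ℝ Y] {C R L : ℝ} (hC : 0 < C) (hL : 0 ≤ L)
    (hc : ∀ j, ‖c j‖ ≤ C) (hG : Continuous fun z : Y × ℝ × (κ → W) => G z.1 z.2.1 z.2.2)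
    {u v : Y → ℝ → κ → W} (hu : Continuous fun z : Y × ℝ => u z.1 z.2)
    (hv : Continuous fun z : Y × ℝ => v z.1 z.2)
    (hLip : ∀ y t, (y, t) ∈ doubleCone Y C R →
      ‖G y t (u y t) - G y t (v y t)‖ ≤ L * ‖u y t - v y t‖)
    (hmu : ∀ y t, (y, t) ∈ doubleCone Y C R → u y t = duhamel c G u₀ u y t)
    (hmv : ∀ y t, (y, t) ∈ doubleCone Y C R → v y t = duhamel c G u₀ v y t)
    (y : Y) (t : ℝ) (h : (y, t) ∈ doubleCone Y C R) : u y t = v y t := by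
  obtain ⟨M, hM⟩ := (isCompact_doubleCone (Y := Y) (R := R) hC).exists_bound_of_continuousOn
    (f := fun z : Y × ℝ => u z.1 z.2 - v z.1 z.2) (hu.sub hv).continuousOn
  have hM0 : 0 ≤ M := (norm_nonneg _).trans (hM _ h)
  have main : ∀ m : ℕ, ∀ y t, (y, t) ∈ doubleCone Y C R →
      ‖u y t - v y t‖ ≤ M * ((L * |t|) ^ m / m.factorial) := by
    intro m
    induction m with
    | zero => intro y t h; simpa using hM (y, t) h
    | succ m ih =>
      intro y t h
      have := norm_duhamel_sub_le (u₀ := u₀) hL hM0 hc hG hu hv hLip m ih y t h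
      rwa [← hmu y t h, ← hmv y t h] at this
  have hlim : Tendsto (fun m : ℕ => M * ((L * |t|) ^ m / m.factorial)) atTop (𝓝 0) := by
    simpa using (FloorSemiring.tendsto_pow_div_factorial_atTop (L * |t|)).const_mul M
  have := ge_of_tendsto' hlim fun m => main m y t h
  exact sub_eq_zero.1 (norm_le_zero_iff.1 this)

/-- Global existence of mild solutions for nonlinearities which are Lipschitz in the unknown,
locally uniformly in space and time. -/
theorem exists_mild [FiniteDimensional ℝ Y] [CompleteSpace W] {C : ℝ} (hC : 0 < C)
    (hc : ∀ j, ‖c j‖ ≤ C) (hG : Continuous fun z : Y × ℝ × (κ → W) => G z.1 z.2.1 z.2.2)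
    (hLip : ∀ R, ∃ L, 0 ≤ L ∧ ∀ y t, (y, t) ∈ doubleCone Y C R → ∀ a b,
      ‖G y t a - G y t b‖ ≤ L * ‖a - b‖) (hu₀ : Continuous u₀) :
    ∃ u : Y → ℝ → κ → W, (Continuous fun z : Y × ℝ => u z.1 z.2) ∧
      ∀ y t, u y t = duhamel c G u₀ u y t := by
  have : ProperSpace Y := FiniteDimensional.proper ℝ Y
  let U : ℕ → Y → ℝ → κ → W := fun m => (duhamel c G u₀)^[m] 0
  have hU : ∀ m, U (m + 1) = duhamel c G u₀ (U m) := fun m =>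
    Function.iterate_succ_apply' _ _ _
  have hUc : ∀ m, Continuous fun z : Y × ℝ => U m z.1 z.2 := by
    intro m
    induction m with
    | zero => exact continuous_const
    | succ m ih => rw [hU]; exact continuous_duhamel hG hu₀ ih
  -- The iterates are the partial sums of their increments, so the Weierstrass test applies on each
  -- cone.
  let f : ℕ → Y × ℝ → κ → W := fun m z => U (m + 1) z.1 z.2 - U m z.1 z.2
  have hfc : ∀ m, Continuous (f m) := fun m => (hUc (m + 1)).sub (hUc m)
  have hsum : ∀ n z, ∑ m ∈ Finset.range n, f m z = U n z.1 z.2 := by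
    intro n z
    have := Finset.sum_range_sub (fun m => U m z.1 z.2) n
    simpa [f, U] using this
  have hbound : ∀ R, ∃ b : ℕ → ℝ, Summable b ∧
      ∀ m z, z ∈ doubleCone Y C R → ‖f m z‖ ≤ b m := by
    intro R
    obtain ⟨L, hL, hLR⟩ := hLip R
    obtain ⟨M, hM⟩ := (isCompact_doubleCone (Y := Y) (R := R) hC).exists_bound_of_continuousOn
      (hfc 0).continuousOn
    have main : ∀ m : ℕ, ∀ y t, (y, t) ∈ doubleCone Y C R →
        ‖U (m + 1) y t - U m y t‖ ≤ max M 0 * ((L * |t|) ^ m / m.factorial) := by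
      intro m
      induction m with
      | zero => intro y t h; simpa using Or.inl (hM (y, t) h)
      | succ m ih =>
        intro y t h
        rw [hU (m + 1)]
        nth_rewrite 2 [hU m]
        exact norm_duhamel_sub_le hL (le_max_right _ _) hc hG (hUc _) (hUc _)
          (fun y t h => hLR y t h _ _) m ih y t h
    refine ⟨fun m => max M 0 * ((L * (|R| / C)) ^ m / m.factorial),
      (Real.summable_pow_div_factorial _).mul_left _, ?_⟩
    rintro m ⟨y, t⟩ h
    refine (main m y t h).trans ?_
    -- The height of the cone turns the time-dependent bound into one summable sequence.
    have ht : |t| ≤ |R| / C := by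
      rw [le_div_iff₀ hC]
      have h' : ‖y‖ + C * |t| ≤ R := h
      have := norm_nonneg y
      have := le_abs_self R
      linarith
    exact mul_le_mul_of_nonneg_left (by gcongr) (le_max_right _ _)
  let u : Y → ℝ → κ → W := fun y t => ∑' m, f m (y, t)
  have hunif : ∀ R, TendstoUniformlyOn (fun n (z : Y × ℝ) => U n z.1 z.2)
      (fun z => u z.1 z.2) atTop (doubleCone Y C R) := by
    intro R
    obtain ⟨b, hb, hfb⟩ := hbound R
    have := tendstoUniformlyOn_tsum_nat hb hfb
    simpa only [hsum] using this
  have huc : Continuous fun z : Y × ℝ => u z.1 z.2 := by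
    refine continuous_iff_continuousAt.2 fun z => ?_
    have hz : doubleCone Y C (‖z.1‖ + C * |z.2| + 1) ∈ 𝓝 z := by
      have ho : IsOpen {w : Y × ℝ | ‖w.1‖ + C * |w.2| < ‖z.1‖ + C * |z.2| + 1} :=
        isOpen_lt (by fun_prop) continuous_const
      refine mem_of_superset (ho.mem_nhds (by simp)) fun w hw => ?_
      simp only [doubleCone, mem_ofPred_eq] at hw ⊢
      exact hw.le
    exact ((hunif _).continuousOn
      (Frequently.of_forall fun n => (hUc n).continuousOn)).continuousAt hz
  refine ⟨u, huc, fun y t => ?_⟩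
  set R := ‖y‖ + C * |t| with hR
  have hmem : (y, t) ∈ doubleCone Y C R := mem_doubleCone_self y t
  obtain ⟨L, hL, hLR⟩ := hLip R
  have h1 : Tendsto (fun n => U n y t) atTop (𝓝 (u y t)) := (hunif R).tendsto_at hmem
  have h2 : Tendsto (fun n => U (n + 1) y t) atTop (𝓝 (duhamel c G u₀ u y t)) := by
    rw [Metric.tendsto_atTop]
    intro ε hε
    have hδ : 0 < ε / (L * |t| + 1) := by positivity
    obtain ⟨N, hN⟩ := eventually_atTop.1 (Metric.tendstoUniformlyOn_iff.1 (hunif R) _ hδ)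
    refine ⟨N, fun n hn => ?_⟩
    rw [dist_eq_norm, hU]
    -- The case m = 0, with the uniform distance ε / (L|t| + 1) between the iterate and the limit as
    -- the constant M.
    refine (norm_duhamel_sub_le (R := R) hL hδ.le hc hG (hUc n) huc
      (fun y t h => hLR y t h _ _) 0 (fun y t h => ?_) y t hmem).trans_lt ?_
    · have := hN n hn (y, t) h
      rw [dist_comm, dist_eq_norm] at this
      simpa using this.le
    · have h0 : 0 ≤ L * |t| := by positivity
      simp only [zero_add, pow_one, Nat.factorial_one, Nat.cast_one, div_one]
      rw [div_mul_eq_mul_div, div_lt_iff₀ (by positivity)]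
      nlinarith
  exact tendsto_nhds_unique (h1.comp (tendsto_add_atTop_nat 1)) h2

end Transport

/-! ### Smoothness of mild solutions, and their equivalence with classical ones -/

section Regularity

/-- The average of the derivative of `f` over the segment from `a` to `b`. -/
noncomputable def avgFDeriv {E F : Type*} [NormedAddCommGroup E] [NormedSpace ℝ E]
    [NormedAddCommGroup F] [NormedSpace ℝ F] (f : E → F) (a b : E) : E →L[ℝ] F :=
  ∫ θ in (0 : ℝ)..1, fderiv ℝ f (a + θ • (b - a))

section

variable {E F : Type*} [NormedAddCommGroup E] [NormedSpace ℝ E]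
    [NormedAddCommGroup F] [NormedSpace ℝ F] [CompleteSpace F]

theorem avgFDeriv_self (f : E → F) (a : E) : avgFDeriv f a a = fderiv ℝ f a := by
  simp [avgFDeriv]

omit [CompleteSpace F] in
theorem continuous_avgFDeriv {f : E → F} (hf : ContDiff ℝ 1 f) :
    Continuous fun z : E × E => avgFDeriv f z.1 z.2 := by
  have h := hf.continuous_fderiv one_ne_zero
  refine intervalIntegral.continuous_parametric_intervalIntegral_of_continuous'
    (f := fun (z : E × E) (θ : ℝ) => fderiv ℝ f (z.1 + θ • (z.2 - z.1))) ?_ 0 1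
  exact h.comp (by fun_prop)

/-- The mean value identity makes difference quotients of a nonlinear equation solve an exactly
linear one, whose coefficients remain continuous as the increment tends to zero. -/
theorem avgFDeriv_apply_sub {f : E → F} (hf : ContDiff ℝ 1 f) (a b : E) :
    avgFDeriv f a b (b - a) = f b - f a := by
  have h := hf.continuous_fderiv one_ne_zero
  have hc : Continuous fun θ : ℝ => fderiv ℝ f (a + θ • (b - a)) := h.comp (by fun_prop)
  rw [avgFDeriv, ContinuousLinearMap.intervalIntegral_apply (hc.intervalIntegrable _ _)]
  have hd : ∀ θ : ℝ, HasDerivAt (fun θ : ℝ => f (a + θ • (b - a)))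
      (fderiv ℝ f (a + θ • (b - a)) (b - a)) θ := by
    intro θ
    have h1 : HasDerivAt (fun θ : ℝ => a + θ • (b - a)) (b - a) θ := by
      simpa using ((hasDerivAt_id θ).smul_const (b - a)).const_add a
    exact ((hf.differentiable one_ne_zero) _).hasFDerivAt.comp_hasDerivAt θ h1
  rw [intervalIntegral.integral_eq_sub_of_hasDerivAt (fun θ _ => hd θ)]
  · simp
  · exact Continuous.intervalIntegrable (hc.clm_apply continuous_const) _ _

end

/-- A function of two real variables with `C^n` partial derivatives is `C^(n+1)`. -/
theorem contDiff_succ_of_partials {W : Type*} [NormedAddCommGroup W] [NormedSpace ℝ W] {n : ℕ}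
    {f f₁ f₂ : ℝ → ℝ → W} (h₁ : ∀ x t, HasDerivAt (fun x' => f x' t) (f₁ x t) x)
    (h₂ : ∀ x t, HasDerivAt (fun t' => f x t') (f₂ x t) t)
    (c₁ : ContDiff ℝ n fun z : ℝ × ℝ => f₁ z.1 z.2)
    (c₂ : ContDiff ℝ n fun z : ℝ × ℝ => f₂ z.1 z.2) :
    ContDiff ℝ (n + 1) fun z : ℝ × ℝ => f z.1 z.2 := by
  rw [contDiff_succ_iff_hasFDerivAt]
  refine ⟨fun z => ((ContinuousLinearMap.toSpanSingleton ℝ (f₁ z.1 z.2)).coprod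
    (ContinuousLinearMap.toSpanSingleton ℝ (f₂ z.1 z.2))), ?_, fun z => ?_⟩
  · have : (fun z : ℝ × ℝ => ((ContinuousLinearMap.toSpanSingleton ℝ (f₁ z.1 z.2)).coprod
        (ContinuousLinearMap.toSpanSingleton ℝ (f₂ z.1 z.2)))) = fun z : ℝ × ℝ =>
        (ContinuousLinearMap.fst ℝ ℝ ℝ).smulRight (f₁ z.1 z.2) +
        (ContinuousLinearMap.snd ℝ ℝ ℝ).smulRight (f₂ z.1 z.2) := by
      ext z <;> simp
    rw [this]
    exact (contDiff_const.smulRight c₁).add (contDiff_const.smulRight c₂)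
  · refine HasStrictFDerivAt.hasFDerivAt (hasStrictFDerivAt_uncurry_coprod (f := f)
      (f₁ := fun x t => ContinuousLinearMap.toSpanSingleton ℝ (f₁ x t))
      (f₂ := fun x t => ContinuousLinearMap.toSpanSingleton ℝ (f₂ x t))
      (Eventually.of_forall fun v => (h₁ v.1 v.2).hasFDerivAt)
      (Eventually.of_forall fun v => (h₂ v.1 v.2).hasFDerivAt) ?_ ?_)
    · exact ((ContinuousLinearMap.toSpanSingletonCLE (𝕜 := ℝ) (E := W)).continuous.comp
        c₁.continuous).continuousAt
    · exact ((ContinuousLinearMap.toSpanSingletonCLE (𝕜 := ℝ) (E := W)).continuous.comp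
        c₂.continuous).continuousAt

variable {κ : Type*} [Fintype κ] {c : κ → ℝ}

section

variable {W : Type*} [NormedAddCommGroup W] [NormedSpace ℝ W] [CompleteSpace W]

omit [CompleteSpace W] [Fintype κ] in
/-- A continuous family of linear operators is bounded on double cones. -/
theorem exists_lipschitz_of_continuous_clm {Y V : Type*} [NormedAddCommGroup Y] [NormedSpace ℝ Y]
    [FiniteDimensional ℝ Y] [NormedAddCommGroup V] [NormedSpace ℝ V] {C : ℝ} (hC : 0 < C)
    {A : Y → ℝ → V →L[ℝ] V}
    (hA : Continuous fun z : Y × ℝ => A z.1 z.2) (R : ℝ) :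
    ∃ L, 0 ≤ L ∧ ∀ y t, (y, t) ∈ doubleCone Y C R → ∀ a b,
      ‖A y t a - A y t b‖ ≤ L * ‖a - b‖ := by
  obtain ⟨M, hM⟩ := (isCompact_doubleCone (Y := Y) (R := R) hC).exists_bound_of_continuousOn
    hA.continuousOn
  refine ⟨max M 0, le_max_right _ _, fun y t h a b => ?_⟩
  rw [← map_sub]
  refine ((A y t).le_opNorm _).trans ?_
  gcongr
  exact (hM (y, t) h).trans (le_max_left _ _)

/-- A continuous mild solution with `C¹` data is differentiable in `x`, and its derivative is a mild
solution of the linearized system. -/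
theorem exists_hasDerivAt_of_mild {F : (κ → W) → κ → W} (hF : ContDiff ℝ 1 F)
    {u₀ : ℝ → κ → W} (hu₀ : ContDiff ℝ 1 u₀) {u : ℝ → ℝ → κ → W}
    (hu : Continuous fun z : ℝ × ℝ => u z.1 z.2)
    (hmild : ∀ x t, u x t = duhamel c (fun _ _ => F) u₀ u x t) :
    ∃ w : ℝ → ℝ → κ → W, (Continuous fun z : ℝ × ℝ => w z.1 z.2) ∧
      (∀ x t, HasDerivAt (fun x' => u x' t) (w x t) x) ∧
      ∀ x t, w x t = duhamel c (fun x t v => fderiv ℝ F (u x t) v) (deriv u₀) w x t := by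
  set C : ℝ := ‖c‖ + 1 with hCdef
  have hC : 0 < C := by positivity
  have hc : ∀ j, ‖c j‖ ≤ C := fun j => (norm_le_pi_norm c j).trans (by linarith)
  let A : ℝ × ℝ → ℝ → (κ → W) →L[ℝ] (κ → W) := fun y t => avgFDeriv F (u y.1 t) (u (y.1 + y.2) t)
  let δ : ℝ × ℝ → κ → W := fun y => avgFDeriv u₀ y.1 (y.1 + y.2) 1
  have hA : Continuous fun z : (ℝ × ℝ) × ℝ => A z.1 z.2 := by
    have h1 : Continuous fun z : (ℝ × ℝ) × ℝ => u z.1.1 z.2 :=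
      hu.comp (f := fun z : (ℝ × ℝ) × ℝ => (z.1.1, z.2)) (by fun_prop)
    have h2 : Continuous fun z : (ℝ × ℝ) × ℝ => u (z.1.1 + z.1.2) z.2 :=
      hu.comp (f := fun z : (ℝ × ℝ) × ℝ => (z.1.1 + z.1.2, z.2)) (by fun_prop)
    exact (continuous_avgFDeriv hF).comp (h1.prodMk h2)
  have hδ : Continuous δ :=
    ((continuous_avgFDeriv hu₀).comp (f := fun y : ℝ × ℝ => (y.1, y.1 + y.2))
      (by fun_prop)).clm_apply continuous_const
  have hGc : Continuous fun z : (ℝ × ℝ) × ℝ × (κ → W) => A z.1 z.2.1 z.2.2 :=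
    (hA.comp (f := fun z : (ℝ × ℝ) × ℝ × (κ → W) => (z.1, z.2.1)) (by fun_prop)).clm_apply
      (by fun_prop)
  -- The increment h is treated as a second space variable with speed 0. The linear system for the
  -- difference quotients is then solved for all h at once, h = 0 included, with a solution
  -- continuous in (x, h, t).
  obtain ⟨d, hd, hdm⟩ := exists_mild (c := fun j => (c j, (0 : ℝ))) (u₀ := δ)
    (G := fun y t v => A y t v) hC (fun j => by simpa [Prod.norm_def] using hc j) hGc
    (exists_lipschitz_of_continuous_clm hC hA) hδ
  have hdm' : ∀ x h t, d (x, h) t = duhamel c (fun x t v => A (x, h) t v) (fun x => δ (x, h))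
      (fun x t => d (x, h) t) x t := by
    intro x h t
    conv_lhs => rw [hdm]
    ext j
    simp [duhamel]
  -- For h ≠ 0 the difference quotient is a mild solution of the same linear system with the same
  -- data, so uniqueness identifies it with d. Letting h tend to 0 gives the derivative.
  have hquot : ∀ h : ℝ, h ≠ 0 → ∀ x t, h⁻¹ • (u (x + h) t - u x t) = d (x, h) t := by
    intro h hh x t
    have hcA : Continuous fun z : ℝ × ℝ => A (z.1, h) z.2 :=
      hA.comp (f := fun z : ℝ × ℝ => ((z.1, h), z.2)) (by fun_prop)
    obtain ⟨L, hL, hLR⟩ := exists_lipschitz_of_continuous_clm hC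
      (A := fun x t => A (x, h) t) hcA (‖x‖ + C * |t|)
    have hcu : Continuous fun z : ℝ × ℝ => u (z.1 + h) z.2 :=
      hu.comp (f := fun z : ℝ × ℝ => (z.1 + h, z.2)) (by fun_prop)
    refine eqOn_doubleCone_of_mild (u := fun x t => h⁻¹ • (u (x + h) t - u x t))
      (v := fun x t => d (x, h) t) (G := fun x t v => A (x, h) t v) (u₀ := fun x => δ (x, h))
      hC hL hc ?_ ?_ ?_ (fun y t hy => hLR y t hy _ _) ?_ (fun x t _ => hdm' x h t) x t
      (mem_doubleCone_self x t)
    · exact hGc.comp (f := fun z : ℝ × ℝ × (κ → W) => ((z.1, h), z.2.1, z.2.2)) (by fun_prop)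
    · exact (hcu.sub hu).const_smul h⁻¹
    · exact hd.comp (f := fun z : ℝ × ℝ => ((z.1, h), z.2)) (by fun_prop)
    · intro x t _
      have e1 : ∀ x, δ (x, h) = h⁻¹ • (u₀ (x + h) - u₀ x) := by
        intro x
        rw [← avgFDeriv_apply_sub hu₀, ← map_smul]
        simp [δ, hh]
      have e2 : ∀ x t, A (x, h) t (h⁻¹ • (u (x + h) t - u x t)) =
          h⁻¹ • (F (u (x + h) t) - F (u x t)) := by
        intro x t
        rw [map_smul, ← avgFDeriv_apply_sub hF]
      have hFu : Continuous fun z : ℝ × ℝ × (κ → W) => F z.2.2 := hF.continuous.comp (by fun_prop)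
      ext j
      have i1 := ((continuous_duhamel_integrand (c := c) (G := fun _ _ => F) hFu hu j).comp
        (Continuous.prodMk_right (x, t))).intervalIntegrable (μ := MeasureTheory.volume) 0 1
      have i2 := ((continuous_duhamel_integrand (c := c) (G := fun _ _ => F) hFu hu j).comp
        (Continuous.prodMk_right (x + h, t))).intervalIntegrable (μ := MeasureTheory.volume) 0 1
      simp only [Function.comp_def] at i1 i2
      simp only [duhamel, e1, e2]
      conv_lhs => rw [hmild (x + h) t, hmild x t]
      simp only [duhamel, Pi.smul_apply, Pi.sub_apply]
      rw [intervalIntegral.integral_smul]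
      simp only [add_right_comm x h] at i2 ⊢
      rw [intervalIntegral.integral_sub i2 i1, smul_comm t h⁻¹, ← smul_add]
      congr 1
      rw [smul_sub]
      abel
  refine ⟨fun x t => d (x, 0) t, hd.comp (f := fun z : ℝ × ℝ => ((z.1, (0 : ℝ)), z.2))
    (by fun_prop), fun x t => ?_, fun x t => ?_⟩
  · rw [hasDerivAt_iff_tendsto_slope_zero]
    have h1 : Continuous fun h : ℝ => d (x, h) t :=
      hd.comp (f := fun h : ℝ => ((x, h), t)) (by fun_prop)
    have h2 : Tendsto (fun h : ℝ => d (x, h) t) (𝓝[≠] 0) (𝓝 (d (x, 0) t)) :=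
      (h1.tendsto 0).mono_left nhdsWithin_le_nhds
    refine h2.congr' ?_
    filter_upwards [self_mem_nhdsWithin] with h hh
    exact (hquot h hh x t).symm
  · have e1 : (fun x => δ (x, 0)) = deriv u₀ := by
      ext1 x
      simp [δ, avgFDeriv_self]
    have e2 : (fun (x t : ℝ) (v : κ → W) => A (x, 0) t v) = fun x t v => fderiv ℝ F (u x t) v := by
      ext1 x; ext1 t; ext1 v
      simp [A, avgFDeriv_self]
    have := hdm' x 0 t
    rwa [e1, e2] at this

omit [Fintype κ] [CompleteSpace W] in
theorem mild_along_characteristic {F : (κ → W) → κ → W} {u₀ : ℝ → κ → W} {u : ℝ → ℝ → κ → W}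
    (hmild : ∀ x t, u x t = duhamel c (fun _ _ => F) u₀ u x t) (x t : ℝ) (j : κ) :
    u (x - t * c j) t j = u₀ x j + ∫ s in (0 : ℝ)..t, F (u (x - s * c j) s) j := by
  rw [hmild]
  simp only [duhamel]
  have h := intervalIntegral.smul_integral_comp_mul_left (a := 0) (b := 1)
    (fun s => F (u (x - s * c j) s) j) t
  rw [mul_zero, mul_one] at h
  rw [← h]
  have e : ∀ θ : ℝ, x - t * c j + t * (1 - θ) * c j = x - t * θ * c j := fun θ => by ring
  simp only [smul_eq_mul, e, sub_add_cancel]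

omit [Fintype κ] in
theorem hasDerivAt_along_characteristic {F : (κ → W) → κ → W} (hF : Continuous F)
    {u₀ : ℝ → κ → W} {u : ℝ → ℝ → κ → W}
    (hu : Continuous fun z : ℝ × ℝ => u z.1 z.2)
    (hmild : ∀ x t, u x t = duhamel c (fun _ _ => F) u₀ u x t) (x t : ℝ) (j : κ) :
    HasDerivAt (fun t => u (x - t * c j) t j) (F (u (x - t * c j) t) j) t := by
  have h : (fun t => u (x - t * c j) t j) =
      fun t => u₀ x j + ∫ s in (0 : ℝ)..t, F (u (x - s * c j) s) j :=
    funext fun t => mild_along_characteristic hmild x t j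
  rw [h]
  have hcont : Continuous fun s => F (u (x - s * c j) s) j :=
    (continuous_apply j).comp (hF.comp
      (hu.comp (f := fun s => (x - s * c j, s)) (by fun_prop)))
  exact (intervalIntegral.integral_hasDerivAt_right (hcont.intervalIntegrable _ _)
    (hcont.stronglyMeasurableAtFilter _ _) hcont.continuousAt).const_add _

/-- The pair (u, ∂ₓu) is a mild solution of a system of the same kind with values in W × W, so the
induction must quantify over W. If that pair is C^n, then so are both partial derivatives of u in
coordinates which straighten a characteristic, and u is C^(n+1). -/
theorem contDiff_nat_of_mild.{u} {κ : Type*} [Fintype κ] {c : κ → ℝ} (n : ℕ) :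
    ∀ (W : Type u) [NormedAddCommGroup W] [NormedSpace ℝ W] [CompleteSpace W]
      (F : (κ → W) → κ → W) (u₀ : ℝ → κ → W) (u : ℝ → ℝ → κ → W),
      ContDiff ℝ ∞ F → ContDiff ℝ ∞ u₀ → (Continuous fun z : ℝ × ℝ => u z.1 z.2) →
      (∀ x t, u x t = duhamel c (fun _ _ => F) u₀ u x t) →
      ContDiff ℝ n fun z : ℝ × ℝ => u z.1 z.2 := by
  induction n with
  | zero =>
    intro W _ _ _ F u₀ u _ _ hu _
    exact_mod_cast contDiff_zero.2 hu
  | succ n ih =>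
    intro W _ _ _ F u₀ u hF hu₀ hu hmild
    have hF1 : ContDiff ℝ 1 F := hF.of_le (by exact_mod_cast le_top)
    obtain ⟨w, hw, hder, hwm⟩ := exists_hasDerivAt_of_mild hF1
      (hu₀.of_le (by exact_mod_cast le_top)) hu hmild
    have hun := ih W F u₀ u hF hu₀ hu hmild
    let p₁ : (κ → W × W) →L[ℝ] (κ → W) :=
      ContinuousLinearMap.pi fun j => (ContinuousLinearMap.fst ℝ W W).comp
        (ContinuousLinearMap.proj j)
    let p₂ : (κ → W × W) →L[ℝ] (κ → W) :=
      ContinuousLinearMap.pi fun j => (ContinuousLinearMap.snd ℝ W W).comp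
        (ContinuousLinearMap.proj j)
    -- The tangent system: F coupled with its linearization.
    let F' : (κ → W × W) → κ → W × W := fun z j => (F (p₁ z) j, fderiv ℝ F (p₁ z) (p₂ z) j)
    let v : ℝ → ℝ → κ → W × W := fun x t j => (u x t j, w x t j)
    have hp₁ : ∀ x t, p₁ (v x t) = u x t := fun x t => rfl
    have hp₂ : ∀ x t, p₂ (v x t) = w x t := fun x t => rfl
    have hF' : ContDiff ℝ ∞ F' := by
      have h1 : ContDiff ℝ ∞ fun z => F (p₁ z) := hF.comp p₁.contDiff
      have h2 : ContDiff ℝ ∞ fun z => fderiv ℝ F (p₁ z) (p₂ z) :=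
        ((hF.fderiv_right (m := ∞) (by simp)).comp p₁.contDiff).clm_apply p₂.contDiff
      rw [contDiff_pi] at h1 h2 ⊢
      exact fun j => (h1 j).prodMk (h2 j)
    have hv₀ : ContDiff ℝ ∞ fun x j => (u₀ x j, deriv u₀ x j) := by
      have h2 : ContDiff ℝ ∞ (deriv u₀) := (contDiff_infty_iff_deriv.1 hu₀).2
      rw [contDiff_pi] at hu₀ h2 ⊢
      exact fun j => (hu₀ j).prodMk (h2 j)
    have hv : Continuous fun z : ℝ × ℝ => v z.1 z.2 :=
      continuous_pi fun j => ((continuous_apply j).comp hu).prodMk ((continuous_apply j).comp hw)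
    have hvm : ∀ x t, v x t = duhamel c (fun _ _ => F') (fun x j => (u₀ x j, deriv u₀ x j)) v x t := by
      intro x t
      ext j : 1
      have hint := ((continuous_duhamel_integrand (c := c) (G := fun _ _ => F')
        (hF'.continuous.comp (by fun_prop)) hv j).comp
        (Continuous.prodMk_right (x, t))).intervalIntegrable (μ := MeasureTheory.volume) 0 1
      simp only [Function.comp_def] at hint
      simp only [duhamel]
      have i1 := (ContinuousLinearMap.fst ℝ W W).intervalIntegral_comp_comm hint
      have i2 := (ContinuousLinearMap.snd ℝ W W).intervalIntegral_comp_comm hint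
      simp only [ContinuousLinearMap.coe_fst', ContinuousLinearMap.coe_snd'] at i1 i2
      refine Prod.ext ?_ ?_
      · simp only [Prod.fst_add, Prod.smul_fst]
        rw [← i1]
        change u x t j = _
        rw [hmild x t]
        rfl
      · simp only [Prod.snd_add, Prod.smul_snd]
        rw [← i2]
        change w x t j = _
        rw [hwm x t]
        rfl
    have hvn := ih (W × W) F' _ v hF' hv₀ hv hvm
    have hwn : ContDiff ℝ n fun z : ℝ × ℝ => w z.1 z.2 := p₂.contDiff.comp hvn
    rw [contDiff_pi]
    intro j
    have hw' : ContDiff ℝ n fun z : ℝ × ℝ => w (z.1 - z.2 * c j) z.2 j :=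
      (contDiff_pi.1 (hwn.comp (f := fun z : ℝ × ℝ => (z.1 - z.2 * c j, z.2))
        (by fun_prop))) j
    have hFu' : ContDiff ℝ n fun z : ℝ × ℝ => F (u (z.1 - z.2 * c j) z.2) j :=
      (contDiff_pi.1 ((hF.of_le (by exact_mod_cast le_top)).comp
        (hun.comp (f := fun z : ℝ × ℝ => (z.1 - z.2 * c j, z.2)) (by fun_prop)))) j
    -- Along the j-th characteristic the time derivative of the component u j is F j, which involves
    -- no derivative of u. The shear is undone afterwards.
    have hz := contDiff_succ_of_partials (f := fun x t => u (x - t * c j) t j)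
      (f₁ := fun x t => w (x - t * c j) t j) (f₂ := fun x t => F (u (x - t * c j) t) j)
      (fun x t => by
        have := hasDerivAt_pi.1 (hder (x - t * c j) t) j
        exact this.comp_sub_const x (t * c j))
      (fun x t => hasDerivAt_along_characteristic hF.continuous hu hmild x t j) hw' hFu'
    have hz' := hz.comp (g := fun z : ℝ × ℝ => u (z.1 - z.2 * c j) z.2 j)
      (f := fun z : ℝ × ℝ => (z.1 + z.2 * c j, z.2)) (by fun_prop)
    simpa [Function.comp_def] using hz'

/-- Continuous mild solutions with smooth data are smooth. -/
theorem contDiff_of_mild {F : (κ → W) → κ → W} (hF : ContDiff ℝ ∞ F)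
    {u₀ : ℝ → κ → W} (hu₀ : ContDiff ℝ ∞ u₀) {u : ℝ → ℝ → κ → W}
    (hu : Continuous fun z : ℝ × ℝ => u z.1 z.2)
    (hmild : ∀ x t, u x t = duhamel c (fun _ _ => F) u₀ u x t) :
    ContDiff ℝ ∞ fun z : ℝ × ℝ => u z.1 z.2 :=
  contDiff_infty.2 fun n => contDiff_nat_of_mild n W F u₀ u hF hu₀ hu hmild

/-- The transport system `∂ₜ uⱼ = cⱼ ∂ₓ uⱼ + Fⱼ(u)` at the point `(x, t)`. -/
def SolvesTransportAt (c : κ → ℝ) (F : (κ → W) → κ → W) (u : ℝ → ℝ → κ → W) (x t : ℝ) : Prop :=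
  ∀ j, deriv (fun t' => u x t' j) t = c j • deriv (fun x' => u x' t j) x + F (u x t) j

end

section

variable {W : Type*} [NormedAddCommGroup W] [NormedSpace ℝ W]

theorem hasDerivAt_line {f : ℝ → ℝ → W} (hf : ContDiff ℝ 1 fun z : ℝ × ℝ => f z.1 z.2)
    {a b : ℝ → ℝ} {a' b' s : ℝ} (ha : HasDerivAt a a' s) (hb : HasDerivAt b b' s) :
    HasDerivAt (fun s => f (a s) (b s))
      (a' • deriv (fun x => f x (b s)) (a s) + b' • deriv (fun t => f (a s) t) (b s)) s := by
  have h := ((hf.differentiable one_ne_zero) (a s, b s)).hasFDerivAt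
  have h1 := h.comp_hasDerivAt s (ha.prodMk hb)
  have h2 := h.comp_hasDerivAt (a s) ((hasDerivAt_id (a s)).prodMk (hasDerivAt_const (a s) (b s)))
  have h3 := h.comp_hasDerivAt (b s) ((hasDerivAt_const (b s) (a s)).prodMk (hasDerivAt_id (b s)))
  have e2 := h2.deriv
  have e3 := h3.deriv
  simp only [Function.comp_def, id_eq] at e2 e3 h1
  rw [e2, e3, ← map_smul, ← map_smul, ← map_add]
  simpa using h1

end

section

variable {W : Type*} [NormedAddCommGroup W] [NormedSpace ℝ W] [CompleteSpace W]

theorem SolvesTransportAt.of_mild {F : (κ → W) → κ → W} (hF : Continuous F)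
    {u₀ : ℝ → κ → W} {u : ℝ → ℝ → κ → W}
    (hu : ContDiff ℝ 1 fun z : ℝ × ℝ => u z.1 z.2)
    (hmild : ∀ x t, u x t = duhamel c (fun _ _ => F) u₀ u x t) (x t : ℝ) :
    SolvesTransportAt c F u x t := by
  intro j
  have h1 := hasDerivAt_along_characteristic hF hu.continuous hmild (x + t * c j) t j
  have h2 := hasDerivAt_line (f := fun x t => u x t j) (contDiff_pi.1 hu j)
    (a := fun s => x + t * c j - s * c j) (b := fun s => s) (s := t)
    (((hasDerivAt_id t).mul_const (c j)).const_sub _) (hasDerivAt_id t)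
  have h3 := h1.unique h2
  simp only [add_sub_cancel_right, one_mul, one_smul, neg_smul] at h3
  rw [h3]
  abel

/-- Along the characteristic segment from (x + t c, 0) to (x, t) the equation says that the
θ-derivative of the j-th component is t F j, so Duhamel's formula is the fundamental theorem of
calculus. Only points of the cone enter. -/
theorem mild_of_solvesTransportAt {F : (κ → W) → κ → W} (hF : Continuous F)
    {u₀ : ℝ → κ → W} {u : ℝ → ℝ → κ → W}
    (hu : ContDiff ℝ 1 fun z : ℝ × ℝ => u z.1 z.2) {C R : ℝ} (hc : ∀ j, ‖c j‖ ≤ C)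
    (hpde : ∀ x t, (x, t) ∈ doubleCone ℝ C R → SolvesTransportAt c F u x t)
    (h₀ : ∀ x, |x| ≤ R → u x 0 = u₀ x) (x t : ℝ) (h : (x, t) ∈ doubleCone ℝ C R) :
    u x t = duhamel c (fun _ _ => F) u₀ u x t := by
  ext j
  have hd : ∀ θ ∈ uIcc (0 : ℝ) 1, HasDerivAt
      (fun θ => u (x + (t * (1 - θ)) • c j) (t * θ) j)
      (t • F (u (x + (t * (1 - θ)) • c j) (t * θ)) j) θ := by
    intro θ hθ
    rw [uIcc_of_le zero_le_one] at hθ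
    have hmem := mem_doubleCone_of_characteristic (hc j) h hθ
    have h2 := hasDerivAt_line (f := fun x t => u x t j) (contDiff_pi.1 hu j)
      (a := fun θ => x + (t * (1 - θ)) • c j) (b := fun θ => t * θ) (s := θ)
      (((((hasDerivAt_id θ).const_sub 1).const_mul t).mul_const (c j)).const_add x)
      ((hasDerivAt_id θ).const_mul t)
    convert! h2 using 1
    rw [hpde _ _ hmem j]
    simp only [smul_add, smul_smul]
    rw [← add_assoc, ← add_smul]
    simp
  have hcont : Continuous fun θ => F (u (x + (t * (1 - θ)) • c j) (t * θ)) j :=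
    (continuous_apply j).comp (hF.comp (hu.continuous.comp
      (f := fun θ : ℝ => (x + (t * (1 - θ)) • c j, t * θ)) (by fun_prop)))
  have key := intervalIntegral.integral_eq_sub_of_hasDerivAt hd
    ((continuous_const.smul hcont).intervalIntegrable _ _)
  rw [intervalIntegral.integral_smul] at key
  have h0 : (x + t * c j, (0 : ℝ)) ∈ doubleCone ℝ C R := by
    simpa using mem_doubleCone_of_characteristic (hc j) h (θ := 0) (by simp)
  simp only [duhamel]
  rw [key, ← h₀ (x + t • c j) (by simpa [doubleCone] using h0)]
  simp

end

end Regularity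

/-! ### Calculus of smooth functions of two variables -/

section PartialDerivatives

variable {W : Type*} [NormedAddCommGroup W] [NormedSpace ℝ W]

/-- Joint smoothness of a function of two real variables. -/
def JointlySmooth (f : ℝ → ℝ → W) : Prop := ContDiff ℝ ∞ fun z : ℝ × ℝ => f z.1 z.2

/-- Partial derivative in the first variable. -/
noncomputable def dx (f : ℝ → ℝ → W) (x t : ℝ) : W := deriv (fun x' => f x' t) x

/-- Partial derivative in the second variable. -/
noncomputable def dt (f : ℝ → ℝ → W) (x t : ℝ) : W := deriv (fun t' => f x t') t

namespace JointlySmooth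

variable {f : ℝ → ℝ → W}

theorem of_le_one (hf : JointlySmooth f) : ContDiff ℝ 1 fun z : ℝ × ℝ => f z.1 z.2 :=
  ContDiff.of_le hf (by exact_mod_cast le_top)

theorem hasDerivAt_comp (hf : JointlySmooth f) {a b : ℝ → ℝ} {a' b' s : ℝ}
    (ha : HasDerivAt a a' s) (hb : HasDerivAt b b' s) :
    HasDerivAt (fun s => f (a s) (b s)) (a' • dx f (a s) (b s) + b' • dt f (a s) (b s)) s :=
  hasDerivAt_line hf.of_le_one ha hb

theorem hasDerivAt_dx (hf : JointlySmooth f) (x t : ℝ) :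
    HasDerivAt (fun x' => f x' t) (dx f x t) x := by
  simpa using hf.hasDerivAt_comp (hasDerivAt_id x) (hasDerivAt_const x t)

theorem hasDerivAt_dt (hf : JointlySmooth f) (x t : ℝ) :
    HasDerivAt (fun t' => f x t') (dt f x t) t := by
  simpa using hf.hasDerivAt_comp (hasDerivAt_const t x) (hasDerivAt_id t)

theorem dx_eq (hf : JointlySmooth f) (x t : ℝ) :
    dx f x t = fderiv ℝ (fun z : ℝ × ℝ => f z.1 z.2) (x, t) (1, 0) := by
  have h := ((hf.of_le_one.differentiable one_ne_zero) (x, t)).hasFDerivAt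
  exact (h.comp_hasDerivAt x ((hasDerivAt_id x).prodMk (hasDerivAt_const x t))).deriv

theorem dt_eq (hf : JointlySmooth f) (x t : ℝ) :
    dt f x t = fderiv ℝ (fun z : ℝ × ℝ => f z.1 z.2) (x, t) (0, 1) := by
  have h := ((hf.of_le_one.differentiable one_ne_zero) (x, t)).hasFDerivAt
  exact (h.comp_hasDerivAt t ((hasDerivAt_const t x).prodMk (hasDerivAt_id t))).deriv

theorem dx (hf : JointlySmooth f) : JointlySmooth (dx f) := by
  have h : ContDiff ℝ ∞ fun z : ℝ × ℝ => fderiv ℝ (fun z : ℝ × ℝ => f z.1 z.2) z (1, 0) :=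
    (ContDiff.fderiv_right hf (m := ∞) (by simp)).clm_apply contDiff_const
  unfold JointlySmooth
  simpa only [hf.dx_eq] using h

theorem dt (hf : JointlySmooth f) : JointlySmooth (dt f) := by
  have h : ContDiff ℝ ∞ fun z : ℝ × ℝ => fderiv ℝ (fun z : ℝ × ℝ => f z.1 z.2) z (0, 1) :=
    (ContDiff.fderiv_right hf (m := ∞) (by simp)).clm_apply contDiff_const
  unfold JointlySmooth
  simpa only [hf.dt_eq] using h

theorem dt_dx (hf : JointlySmooth f) (x t : ℝ) : _root_.dt (_root_.dx f) x t =
    _root_.dx (_root_.dt f) x t := by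
  have hs : IsSymmSndFDerivAt ℝ (fun z : ℝ × ℝ => f z.1 z.2) (x, t) :=
    ContDiffAt.isSymmSndFDerivAt (ContDiff.contDiffAt hf)
      (by simpa using WithTop.coe_le_coe.2 (le_top : (2 : ℕ∞) ≤ ⊤))
  have h' : ContDiff ℝ ∞ (fderiv ℝ fun z : ℝ × ℝ => f z.1 z.2) :=
    ContDiff.fderiv_right hf (m := ∞) (by simp)
  have key : ∀ v : ℝ × ℝ, fderiv ℝ (fun z => fderiv ℝ (fun z : ℝ × ℝ => f z.1 z.2) z v) (x, t) =
      (fderiv ℝ (fderiv ℝ fun z : ℝ × ℝ => f z.1 z.2) (x, t)).flip v := by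
    intro v
    have h1 := ((h'.differentiable (by simp)) (x, t)).hasFDerivAt.clm_apply
      (hasFDerivAt_const v (x, t))
    rw [h1.fderiv]
    ext <;> simp
  rw [hf.dx.dt_eq, hf.dt.dx_eq]
  simp only [hf.dx_eq, hf.dt_eq]
  rw [key, key]
  exact hs _ _

protected theorem continuous (hf : JointlySmooth f) : Continuous fun z : ℝ × ℝ => f z.1 z.2 :=
  ContDiff.continuous hf

theorem bilin {X Y : ℝ → ℝ → W} {Z : Type*} [NormedAddCommGroup Z] [NormedSpace ℝ Z]
    (hX : JointlySmooth X) (hY : JointlySmooth Y) (β : W →L[ℝ] W →L[ℝ] Z) :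
    JointlySmooth fun x t => β (X x t) (Y x t) :=
  (β.contDiff.comp hX).clm_apply hY

end JointlySmooth

theorem HasDerivAt.bilin {Z : Type*} [NormedAddCommGroup Z] [NormedSpace ℝ Z] {X Y : ℝ → W}
    {X' Y' : W} {s : ℝ} (hX : HasDerivAt X X' s) (hY : HasDerivAt Y Y' s)
    (β : W →L[ℝ] W →L[ℝ] Z) :
    HasDerivAt (fun s => β (X s) (Y s)) (β (X s) Y' + β X' (Y s)) s :=
  β.hasDerivAt_of_bilinear (fun _ => hX) fun _ => hY

end PartialDerivatives

/-! ### Algebra of the system: reflections, propagation of the constraint, energy and null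
identities -/

/-- The algebraic data of the reduced system on a normed space: a Lie bracket `br`, a positive
definite form `g` and a skew form `p` invariant under `ad R`, and the operations `cg`, `q` which
they define. -/
structure FrameAlgebra (W : Type*) [NormedAddCommGroup W] [NormedSpace ℝ W] where
  br : W →L[ℝ] W →L[ℝ] W
  g : W →L[ℝ] W →L[ℝ] ℝ
  p : W →L[ℝ] W →L[ℝ] ℝ
  cg : W →L[ℝ] W →L[ℝ] W
  q : W →L[ℝ] W →L[ℝ] W
  R : W
  br_skew : ∀ X Y, br X Y = -br Y X
  jacobi : ∀ X Y Z, br X (br Y Z) = br (br X Y) Z + br Y (br X Z)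
  g_symm : ∀ X Y, g X Y = g Y X
  p_skew : ∀ X Y, p X Y = -p Y X
  g_pos : ∃ c, 0 < c ∧ ∀ X, c * ‖X‖ ^ 2 ≤ g X X
  g_cg : ∀ X Y Z, g X (cg Y Z) = g (br X Y) Z
  g_q : ∀ X Y Z, g X (q Y Z) = 1 / 2 * (p X (br Y Z) + p Y (br Z X) + p Z (br X Y))
  g_R : ∀ X Y, g X (br Y R) = -g Y (br X R)
  p_R : ∀ X Y, p X (br Y R) = p Y (br X R)

namespace FrameAlgebra

variable {W : Type*} [NormedAddCommGroup W] [NormedSpace ℝ W] (D : FrameAlgebra W)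

/-- The right-hand side of the equation for `B`, without `∂ₓ E`. -/
noncomputable def source (vt vx vy lam s : ℝ) (E H B : W) : W :=
  s • D.br H D.R - (D.cg B B - D.cg E E - D.cg H H) -
    lam • (vy • D.q B E - vx • D.q B H + vt • D.q E H)

/-- The evolution equations at a point. -/
structure SolvesAt (vt vx vy lam s : ℝ) (E H B : ℝ → ℝ → W) (x t : ℝ) : Prop where
  eqE : dt E x t = dx B x t - D.br (B x t) (E x t)
  eqH : dt H x t = -D.br (B x t) (H x t - D.R)
  eqB : dt B x t = dx E x t + D.source vt vx vy lam s (E x t) (H x t) (B x t)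

/-- The constraint at a point. -/
def ConstraintAt (E H : ℝ → ℝ → W) (x t : ℝ) : Prop :=
  dx H x t = -D.br (E x t) (H x t - D.R)

theorem br_self (X : W) : D.br X X = 0 := by
  have h : (2 : ℝ) • D.br X X = 0 := by
    rw [two_smul]
    nth_rewrite 1 [D.br_skew]
    exact neg_add_cancel _
  exact (smul_eq_zero.1 h).resolve_left two_ne_zero

theorem g_q_self_left (X Y : W) : D.g X (D.q X Y) = 0 := by
  rw [D.g_q, D.br_self, D.br_skew Y X]
  simp

theorem g_q_self_right (X Y : W) : D.g X (D.q Y X) = 0 := by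
  rw [D.g_q, D.br_self, D.br_skew Y X]
  simp

variable {D} {vt vx vy lam s : ℝ}

/-- E is odd under x ↦ -x, B is odd under t ↦ -t, and H is even; the changes of sign are absorbed by
the constants v. A bound for E + B in forward time that holds for all v thus yields the bounds for E
- B and for backward time. -/
theorem SolvesAt.reflect {a b : ℝ} (ha : a = 1 ∨ a = -1) (hb : b = 1 ∨ b = -1)
    {E H B : ℝ → ℝ → W} (hE : JointlySmooth E) (hH : JointlySmooth H) (hB : JointlySmooth B)
    {x t : ℝ} (h : D.SolvesAt vt vx vy lam s E H B (a * x) (b * t)) :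
    D.SolvesAt (a * vt) (b * vx) (a * b * vy) lam s (fun x t => a • E (a * x) (b * t))
      (fun x t => H (a * x) (b * t)) (fun x t => b • B (a * x) (b * t)) x t := by
  have ax : ∀ x, HasDerivAt (fun x => a * x) a x := fun x => by
    simpa using (hasDerivAt_id x).const_mul a
  have bt : ∀ t, HasDerivAt (fun t => b * t) b t := fun t => by
    simpa using (hasDerivAt_id t).const_mul b
  have dxc : ∀ {f : ℝ → ℝ → W}, JointlySmooth f →
      HasDerivAt (fun x => f (a * x) (b * t)) (a • dx f (a * x) (b * t)) x := fun hf => by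
    simpa using hf.hasDerivAt_comp (ax x) (hasDerivAt_const x (b * t))
  have dtc : ∀ {f : ℝ → ℝ → W}, JointlySmooth f →
      HasDerivAt (fun t => f (a * x) (b * t)) (b • dt f (a * x) (b * t)) t := fun hf => by
    simpa using hf.hasDerivAt_comp (hasDerivAt_const t (a * x)) (bt t)
  have haa : a * a = 1 := by rcases ha with rfl | rfl <;> norm_num
  have hbb : b * b = 1 := by rcases hb with rfl | rfl <;> norm_num
  have e1 : dt (fun x t => a • E (a * x) (b * t)) x t = a • b • dt E (a * x) (b * t) :=
    ((dtc hE).const_smul a).deriv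
  have e2 : dx (fun x t => a • E (a * x) (b * t)) x t = a • a • dx E (a * x) (b * t) :=
    ((dxc hE).const_smul a).deriv
  have e3 : dt (fun x t => b • B (a * x) (b * t)) x t = b • b • dt B (a * x) (b * t) :=
    ((dtc hB).const_smul b).deriv
  have e4 : dx (fun x t => b • B (a * x) (b * t)) x t = b • a • dx B (a * x) (b * t) :=
    ((dxc hB).const_smul b).deriv
  have e5 : dt (fun x t => H (a * x) (b * t)) x t = b • dt H (a * x) (b * t) := (dtc hH).deriv
  refine ⟨?_, ?_, ?_⟩
  · rw [e1, e4, h.eqE]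
    simp only [map_smul, smul_apply, smul_sub, smul_smul, mul_comm]
  · rw [e5, h.eqH]
    simp only [map_smul, smul_apply, smul_neg]
  · rw [e2, e3, h.eqB, smul_smul, smul_smul, haa, hbb, one_smul, one_smul]
    congr 1
    simp only [source, map_smul, smul_apply, smul_smul, haa, hbb, one_smul]
    have r1 : a * b * vy * (a * b) = vy := by linear_combination (b * b * vy) * haa + vy * hbb
    have r2 : b * vx * b = vx := by linear_combination vx * hbb
    have r3 : a * vt * a = vt := by linear_combination vt * haa
    simp only [r1, r2, r3]

theorem ConstraintAt.reflect {a b : ℝ}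
    {E H : ℝ → ℝ → W} (hH : JointlySmooth H)
    {x t : ℝ} (h : D.ConstraintAt E H (a * x) (b * t)) :
    D.ConstraintAt (fun x t => a • E (a * x) (b * t)) (fun x t => H (a * x) (b * t)) x t := by
  have ax : HasDerivAt (fun x => a * x) a x := by
    simpa using (hasDerivAt_id x).const_mul a
  have e1 : dx (fun x t => H (a * x) (b * t)) x t = a • dx H (a * x) (b * t) := by
    simpa using! (hH.hasDerivAt_comp ax (hasDerivAt_const x (b * t))).deriv
  unfold ConstraintAt at h ⊢
  rw [e1, h]
  simp only [map_smul, smul_apply, smul_neg]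

theorem _root_.JointlySmooth.reflect {f : ℝ → ℝ → W} (hf : JointlySmooth f) (a b k : ℝ) :
    JointlySmooth fun x t => k • f (a * x) (b * t) :=
  contDiff_const.smul (ContDiff.comp (f := fun z : ℝ × ℝ => (a * z.1, b * z.2)) hf (by fun_prop))

/-- The constraint is propagated by the evolution equations. -/
theorem ConstraintAt.propagate {E H B : ℝ → ℝ → W} (hE : JointlySmooth E) (hH : JointlySmooth H)
    (hB : JointlySmooth B) {x T : ℝ} (hT : 0 ≤ T)
    (hsol : ∀ t ∈ Icc 0 T, ∀ᶠ x' in 𝓝 x, D.SolvesAt vt vx vy lam s E H B x' t)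
    (h₀ : D.ConstraintAt E H x 0) : D.ConstraintAt E H x T := by
  -- The defect of the constraint. By the Jacobi identity it satisfies Z' = -[B, Z], so it vanishes
  -- if it vanishes initially.
  let Z : ℝ → W := fun t => dx H x t + D.br (E x t) (H x t - D.R)
  have hZ : ∀ t ∈ Icc 0 T, HasDerivAt Z (-D.br (B x t) (Z t)) t := by
    intro t ht
    have h1 := (hH.dx.hasDerivAt_dt x t).add
      ((hE.hasDerivAt_dt x t).bilin ((hH.hasDerivAt_dt x t).sub_const D.R) D.br)
    refine h1.congr_deriv ?_
    -- The equation for H is differentiated in x, so it has to hold in a neighbourhood of x.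
    have h2 : dx (dt H) x t = -(D.br (B x t) (dx H x t) + D.br (dx B x t) (H x t - D.R)) := by
      have h3 := ((hB.hasDerivAt_dx x t).bilin ((hH.hasDerivAt_dx x t).sub_const D.R) D.br).neg
      have h4 : (fun x' => dt H x' t) =ᶠ[𝓝 x] fun x' => -D.br (B x' t) (H x' t - D.R) := by
        filter_upwards [hsol t ht] with x' hx' using hx'.eqH
      exact h4.deriv_eq.trans h3.deriv
    have hs := (hsol t ht).self_of_nhds
    rw [hH.dt_dx, h2, hs.eqE, hs.eqH]
    simp only [Z, map_add, map_sub, map_neg, sub_apply]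
    have j1 := D.jacobi (B x t) (E x t) (H x t)
    have j2 := D.jacobi (B x t) (E x t) D.R
    rw [j1, j2]
    abel
  have hcont : Continuous fun t => B x t :=
    hB.continuous.comp (f := fun t => (x, t)) (by fun_prop)
  obtain ⟨K, hK⟩ := (isCompact_Icc (a := 0) (b := T)).exists_bound_of_continuousOn
    hcont.continuousOn
  have := eq_zero_of_abs_deriv_le_mul_abs_self_of_eq_zero_right (f := Z)
    (f' := fun t => -D.br (B x t) (Z t)) (K := ‖D.br‖ * K) (a := 0) (b := T)
    (fun t ht => (hZ t ht).continuousAt.continuousWithinAt)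
    (fun t ht => (hZ t (Ico_subset_Icc_self ht)).hasDerivWithinAt)
    (by simp only [Z]; rw [show dx H x 0 = _ from h₀]; simp)
    (fun t ht => by
      rw [norm_neg]
      refine (D.br.le_opNorm₂ _ _).trans ?_
      gcongr
      exact hK t (Ico_subset_Icc_self ht)) T ⟨hT, le_rfl⟩
  exact eq_neg_of_add_eq_zero_left this

/-- Energy density. -/
noncomputable def energy (D : FrameAlgebra W) (μ : ℝ) (E H B : W) : ℝ :=
  1 / 2 * (D.g B B + D.g E E + D.g H H) + μ * D.p H E

/-- Energy flux density. -/
noncomputable def flux (D : FrameAlgebra W) (μ : ℝ) (E H B : W) : ℝ :=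
  D.g E B + μ * D.p H B

/-- The `cg` terms cancel against the brackets in the equations for E and H. The torsion terms with
vx and vy vanish when paired with B; the one with vₜ is -λ vₜ/2 times a cyclic sum of p, which the
constraint reproduces from the p-term of energy and flux precisely for this μ. Invariance of p
removes the terms with R, and invariance of g merges theirs into the factor s - 1. -/
theorem energy_identity (E H B Ex Hx Bx : W) (hHx : Hx = -D.br E (H - D.R)) {μ : ℝ}
    (hμ : μ = -(lam * vt / 2)) :
    D.g B (Ex + D.source vt vx vy lam s E H B) + D.g E (Bx - D.br B E)
      + D.g H (-D.br B (H - D.R)) + μ * (D.p H (Bx - D.br B E) + D.p (-D.br B (H - D.R)) E) =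
    (D.g E Bx + D.g Ex B + μ * (D.p H Bx + D.p Hx B)) + (s - 1) * D.g B (D.br H D.R) := by
  subst hHx hμ
  simp only [source, map_add, map_sub, map_neg, map_smul, neg_apply,
    sub_apply, smul_eq_mul, D.g_cg, D.g_q_self_left, D.g_q, D.br_self,
    map_zero, zero_apply]
  rw [D.br_skew H B, D.g_R H B, D.p_skew (D.br B H) E, D.p_skew (D.br E H) B,
    D.p_skew (D.br B D.R) E, D.p_skew (D.br E D.R) B, D.p_R E B, D.g_symm (D.br B E) E,
    D.g_symm (D.br B H) H, D.g_symm Ex B]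
  simp only [map_neg]
  ring

/-- The energy leaving a backward triangle through its right side involves E - B and H, the
components which cross that side, but not E + B, which runs along it. On the left side the roles are
exchanged. -/
theorem energy_sub_flux (μ : ℝ) (E H B : W) :
    D.energy μ E H B - D.flux μ E H B =
      1 / 2 * (D.g (E - B) (E - B) + D.g H H) + μ * D.p H (E - B) := by
  simp only [energy, flux, map_sub, sub_apply]
  rw [D.g_symm B E]
  ring

theorem energy_add_flux (μ : ℝ) (E H B : W) :
    D.energy μ E H B + D.flux μ E H B =
      1 / 2 * (D.g (E + B) (E + B) + D.g H H) + μ * D.p H (E + B) := by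
  simp only [energy, flux, map_add, add_apply]
  rw [D.g_symm B E]
  ring

/-- The null structure: products of waves moving in the same direction cancel. -/
theorem null_identity (E H B : W) :
    D.g (E + B) (D.source vt vx vy lam s E H B - D.br B E) =
      s * D.g (E + B) (D.br H D.R) + D.g (D.br (E + B) H) H
        - lam * ((vx + vt) / 2) * D.g (E + B) (D.q (E - B) H) := by
  -- In vₜ E - vx B the part along E + B drops out by total antisymmetry of q; the part along E - B
  -- has coefficient (vx + vₜ)/2.
  have h1 : D.g (E + B) (D.q (E + B) H) = 0 := D.g_q_self_left _ _
  have h2 := D.g_q_self_left B E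
  have h3 := D.g_q_self_right E B
  have h4 := D.g_symm (D.br B E) E
  have h5 := D.g_symm (D.br B E) B
  simp only [source, map_add, map_sub, map_neg, map_smul, neg_apply,
    add_apply,
    sub_apply, smul_eq_mul, D.g_cg, D.br_self,
    map_zero, zero_apply, D.br_skew E B] at h1 ⊢
  linear_combination (-lam * vt + lam * (vx + vt) / 2) * h1 - lam * vy * (h2 + h3) + h4 + h5

end FrameAlgebra

/-! ### Energy balance on backward triangles and a Gronwall inequality -/

section Calculus

theorem hasDerivAt_intervalIntegral_param {F F' : ℝ → ℝ → ℝ} {a b : ℝ}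
    (hF : ∀ t ξ, HasDerivAt (fun t => F t ξ) (F' t ξ) t)
    (cF : Continuous fun z : ℝ × ℝ => F z.1 z.2) (cF' : Continuous fun z : ℝ × ℝ => F' z.1 z.2)
    (t : ℝ) : HasDerivAt (fun t => ∫ ξ in a..b, F t ξ) (∫ ξ in a..b, F' t ξ) t := by
  obtain ⟨K, hK⟩ := ((isCompact_closedBall t 1).prod
    (isCompact_uIcc (a := a) (b := b))).exists_bound_of_continuousOn cF'.continuousOn
  have c1 : ∀ t, Continuous fun ξ => F t ξ := fun t => cF.comp (Continuous.prodMk_right t)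
  have c2 : ∀ t, Continuous fun ξ => F' t ξ := fun t => cF'.comp (Continuous.prodMk_right t)
  refine (intervalIntegral.hasDerivAt_integral_of_dominated_loc_of_deriv_le
    (Metric.closedBall_mem_nhds t one_pos)
    (Eventually.of_forall fun t => (c1 t).aestronglyMeasurable)
    ((c1 t).intervalIntegrable _ _) (c2 t).aestronglyMeasurable (bound := fun _ => K)
    (Eventually.of_forall fun ξ hξ t' ht' => hK (t', ξ) ⟨ht', uIoc_subset_uIcc hξ⟩)
    (continuous_const.intervalIntegrable _ _)
    (Eventually.of_forall fun ξ _ t' _ => hF t' ξ)).2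

theorem antitoneOn_Icc_of_hasDerivAt_nonpos {Z Z' : ℝ → ℝ} {T : ℝ}
    (hZ : ∀ t, HasDerivAt Z (Z' t) t) (h : ∀ t ∈ Icc 0 T, Z' t ≤ 0) : AntitoneOn Z (Icc 0 T) :=
  antitoneOn_of_deriv_nonpos (convex_Icc 0 T)
    (fun t _ => (hZ t).continuousAt.continuousWithinAt)
    (fun t _ => (hZ t).differentiableAt.differentiableWithinAt)
    fun t ht => by
      rw [(hZ t).deriv]
      exact h t (interior_subset ht)

/-- An energy balance with nonnegative flux through the sides of a backward triangle bounds the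
total flux through its right side. -/
theorem integral_flux_le {e f : ℝ → ℝ → ℝ} (he : JointlySmooth e) (hf : JointlySmooth f)
    {x₀ T k M : ℝ} (hT : 0 ≤ T) (hk : 0 ≤ k)
    (hid : ∀ x t, 0 ≤ t → |x - x₀| ≤ T - t → dt e x t ≤ dx f x t + k * e x t)
    (hsub : ∀ x t, 0 ≤ t → |x - x₀| ≤ T - t → 0 ≤ e x t - f x t)
    (hadd : ∀ x t, 0 ≤ t → |x - x₀| ≤ T - t → 0 ≤ e x t + f x t)
    (h₀ : ∀ x, |x - x₀| ≤ T → e x 0 ≤ M) :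
    ∫ t in (0 : ℝ)..T, (e (x₀ + (T - t)) t - f (x₀ + (T - t)) t) ≤
      Real.exp (k * T) * (2 * T * M) := by
  -- The energy of the time slice |x - x₀| ≤ T - t, rescaled to a fixed interval so that it can be
  -- differentiated under the integral sign.
  let I : ℝ → ℝ := fun t => ∫ ξ in (-1 : ℝ)..1, (T - t) * e (x₀ + (T - t) * ξ) t
  let I' : ℝ → ℝ := fun t => ∫ ξ in (-1 : ℝ)..1,
    ((T - t) * (-ξ * dx e (x₀ + (T - t) * ξ) t + dt e (x₀ + (T - t) * ξ) t)
      + -1 * e (x₀ + (T - t) * ξ) t)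
  have hsubT : ∀ t, HasDerivAt (fun t => T - t) (-1) t := fun t =>
    (hasDerivAt_id t).const_sub T
  have cont : ∀ {u : ℝ → ℝ → ℝ}, JointlySmooth u →
      Continuous fun z : ℝ × ℝ => u (x₀ + (T - z.1) * z.2) z.1 := fun hu =>
    hu.continuous.comp (f := fun z : ℝ × ℝ => (x₀ + (T - z.1) * z.2, z.1)) (by fun_prop)
  have cT : Continuous fun z : ℝ × ℝ => T - z.1 := by fun_prop
  have hI : ∀ t, HasDerivAt I (I' t) t := by
    refine hasDerivAt_intervalIntegral_param (fun t ξ => ?_) ?_ ?_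
    · have h1 := he.hasDerivAt_comp (((hsubT t).mul_const ξ).const_add x₀) (hasDerivAt_id t)
      refine ((hsubT t).mul h1).congr_deriv ?_
      simp only [smul_eq_mul, id_eq]
      ring
    · exact cT.mul (cont he)
    · exact (cT.mul ((continuous_snd.neg.mul (cont he.dx)).add (cont he.dt))).add
        (continuous_const.mul (cont he))
  let P : ℝ → ℝ := fun t => e (x₀ + (T - t)) t - f (x₀ + (T - t)) t
  have hP : Continuous P := by
    have h1 := he.continuous.comp (f := fun t : ℝ => (x₀ + (T - t), t)) (by fun_prop)
    have h2 := hf.continuous.comp (f := fun t : ℝ => (x₀ + (T - t), t)) (by fun_prop)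
    exact h1.sub h2
  have hI' : ∀ t ∈ Icc 0 T, I' t ≤ k * I t - P t := by
    intro t ht
    have cont' : ∀ {u : ℝ → ℝ → ℝ}, JointlySmooth u →
        Continuous fun ξ : ℝ => u (x₀ + (T - t) * ξ) t := fun hu =>
      hu.continuous.comp (f := fun ξ : ℝ => (x₀ + (T - t) * ξ, t)) (by fun_prop)
    have k1 := (continuous_const (y := T - t)).mul (cont' hf.dx) |>.sub
      ((cont' he).add (continuous_id.mul ((continuous_const (y := T - t)).mul (cont' he.dx))))
    have k2 := (continuous_const (y := k)).mul ((continuous_const (y := T - t)).mul (cont' he))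
    have k3 := ((continuous_const (y := T - t)).mul
      ((continuous_id.neg.mul (cont' he.dx)).add (cont' he.dt))).add
      ((continuous_const (y := (-1 : ℝ))).mul (cont' he))
    -- The flux together with the motion of the endpoints is a total ξ-derivative; it integrates to
    -- -(e - f) at the right end and -(e + f) at the left end.
    have hG : ∀ ξ : ℝ, HasDerivAt
        (fun ξ => f (x₀ + (T - t) * ξ) t - ξ * e (x₀ + (T - t) * ξ) t)
        ((T - t) * dx f (x₀ + (T - t) * ξ) t -
          (e (x₀ + (T - t) * ξ) t + ξ * ((T - t) * dx e (x₀ + (T - t) * ξ) t))) ξ := by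
      intro ξ
      have l : HasDerivAt (fun ξ => x₀ + (T - t) * ξ) (T - t) ξ := by
        simpa using ((hasDerivAt_id ξ).const_mul (T - t)).const_add x₀
      have h1 := he.hasDerivAt_comp l (hasDerivAt_const ξ t)
      have h2 := hf.hasDerivAt_comp l (hasDerivAt_const ξ t)
      refine (h2.sub ((hasDerivAt_id ξ).mul h1)).congr_deriv ?_
      simp only [smul_eq_mul, id_eq]
      ring
    have hint := intervalIntegral.integral_eq_sub_of_hasDerivAt (a := -1) (b := 1)
      (fun ξ _ => hG ξ) (k1.intervalIntegrable _ _)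
    have hle : I' t ≤ ∫ ξ in (-1 : ℝ)..1, (((T - t) * dx f (x₀ + (T - t) * ξ) t -
          (e (x₀ + (T - t) * ξ) t + ξ * ((T - t) * dx e (x₀ + (T - t) * ξ) t))) +
          k * ((T - t) * e (x₀ + (T - t) * ξ) t)) := by
      refine intervalIntegral.integral_mono_on (by norm_num) (k3.intervalIntegrable _ _)
        ((k1.add k2).intervalIntegrable _ _) fun ξ hξ => ?_
      have hTt : 0 ≤ T - t := sub_nonneg.2 ht.2
      have h1 := hid (x₀ + (T - t) * ξ) t ht.1 (by
        rw [add_sub_cancel_left, abs_mul, abs_of_nonneg hTt]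
        have : |ξ| ≤ 1 := abs_le.2 hξ
        nlinarith)
      nlinarith
    have hsplit := intervalIntegral.integral_add (μ := MeasureTheory.volume)
      (k1.intervalIntegrable (-1) 1) (k2.intervalIntegrable (-1) 1)
    simp only [Pi.sub_apply, Pi.mul_apply, Pi.add_apply, id_eq] at hsplit
    rw [hsplit, hint, intervalIntegral.integral_const_mul] at hle
    -- The loss through the left side has a favourable sign and is discarded.
    have hN := hadd (x₀ + (T - t) * -1) t ht.1 (by
      have hTt : 0 ≤ T - t := sub_nonneg.2 ht.2
      rw [add_sub_cancel_left, mul_neg_one, abs_neg, abs_of_nonneg hTt])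
    simp only [mul_one] at hle
    simp only [P, I]
    linarith
  have hPnn : ∀ t ∈ Icc 0 T, 0 ≤ P t := fun t ht => hsub _ t ht.1 (by
    rw [add_sub_cancel_left, abs_of_nonneg (sub_nonneg.2 ht.2)])
  have hexp : ∀ t, HasDerivAt (fun t => Real.exp (-(k * t))) (Real.exp (-(k * t)) * -k) t := by
    intro t
    simpa using (((hasDerivAt_id t).const_mul k).neg).exp
  have hPint : ∀ t, HasDerivAt (fun t => ∫ s in (0 : ℝ)..t, P s) (P t) t := fun t =>
    intervalIntegral.integral_hasDerivAt_right (hP.intervalIntegrable _ _)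
      (hP.stronglyMeasurableAtFilter _ _) hP.continuousAt
  -- exp(-kt) I + exp(-kT) ∫ P decreases, since I' ≤ kI - P with P ≥ 0. As I vanishes at T,
  -- comparing both ends bounds the integral of P.
  have hanti := antitoneOn_Icc_of_hasDerivAt_nonpos (T := T)
    (fun t => ((hexp t).mul (hI t)).add ((hPint t).const_mul (Real.exp (-(k * T))))) (by
      intro t ht
      have h1 := hI' t ht
      have h2 := hPnn t ht
      have h3 : Real.exp (-(k * T)) ≤ Real.exp (-(k * t)) :=
        Real.exp_le_exp.2 (by nlinarith [ht.2])
      have h4 := Real.exp_pos (-(k * t))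
      nlinarith)
  have hfin := hanti (left_mem_Icc.2 hT) (right_mem_Icc.2 hT) hT
  have hIT : I T = 0 := by simp [I]
  have hI0 : I 0 ≤ 2 * T * M := by
    have : I 0 ≤ ∫ _ in (-1 : ℝ)..1, T * M := by
      refine intervalIntegral.integral_mono_on (by norm_num) ?_
        (continuous_const.intervalIntegrable _ _) fun ξ hξ => ?_
      · have h := (cT.mul (cont he)).comp (Continuous.prodMk_right 0)
        exact h.intervalIntegrable _ _
      · rw [sub_zero]
        refine mul_le_mul_of_nonneg_left (h₀ _ ?_) hT
        rw [add_sub_cancel_left, abs_mul, abs_of_nonneg hT]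
        have : |ξ| ≤ 1 := abs_le.2 hξ
        nlinarith
    rw [intervalIntegral.integral_const, smul_eq_mul] at this
    linarith
  simp only [Pi.add_apply, Pi.mul_apply, hIT, mul_zero, zero_add, intervalIntegral.integral_same, add_zero, neg_zero,
    Real.exp_zero, one_mul] at hfin
  calc ∫ t in (0 : ℝ)..T, P t
      = Real.exp (k * T) * (Real.exp (-(k * T)) * ∫ t in (0 : ℝ)..T, P t) := by
        rw [← mul_assoc, ← Real.exp_add]
        simp
    _ ≤ Real.exp (k * T) * (2 * T * M) := by
        have := hfin.trans hI0
        gcongr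

/-- Gronwall's inequality with integrating factor exp(-C(t + ∫ P)). Only the integral of P enters,
and this is all that the energy flux controls. -/
theorem one_add_le_exp_integral {q q' P : ℝ → ℝ} {T C : ℝ} (hT : 0 ≤ T)
    (hq : ∀ t, HasDerivAt q (q' t) t) (hP : Continuous P)
    (h : ∀ t ∈ Icc 0 T, q' t ≤ C * ((1 + q t) * (1 + P t))) :
    1 + q T ≤ (1 + q 0) * Real.exp (C * (T + ∫ t in (0 : ℝ)..T, P t)) := by
  have hPint : ∀ t, HasDerivAt (fun t => ∫ s in (0 : ℝ)..t, P s) (P t) t := fun t =>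
    intervalIntegral.integral_hasDerivAt_right (hP.intervalIntegrable _ _)
      (hP.stronglyMeasurableAtFilter _ _) hP.continuousAt
  have hanti := antitoneOn_Icc_of_hasDerivAt_nonpos (T := T)
    (fun t => ((hq t).const_add 1).mul
      ((((hasDerivAt_id t).add (hPint t)).const_mul C).neg.exp)) (by
      intro t ht
      have h1 := h t ht
      set X := Real.exp _
      have h4 : 0 < X := Real.exp_pos _
      nlinarith)
  have hfin := hanti (left_mem_Icc.2 hT) (right_mem_Icc.2 hT) hT
  simp only [Pi.mul_apply, Pi.add_apply, Pi.neg_apply, id_eq, intervalIntegral.integral_same,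
    add_zero, mul_zero, neg_zero, Real.exp_zero, mul_one] at hfin
  rw [Real.exp_neg, ← div_eq_mul_inv, div_le_iff₀ (Real.exp_pos _)] at hfin
  exact hfin

end Calculus

/-! ### A priori bounds -/

namespace FrameAlgebra

variable {W : Type*} [NormedAddCommGroup W] [NormedSpace ℝ W] {D : FrameAlgebra W}
  {vt vx vy lam s R τ M : ℝ} {E H B : ℝ → ℝ → W}

/-- A smooth solution of the system in the slab `|t| ≤ τ` of a double cone, with bounded initial
data satisfying the constraint. -/
structure LocalSolution (D : FrameAlgebra W) (vt vx vy lam s R τ M : ℝ) (E H B : ℝ → ℝ → W) :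
    Prop where
  smooth_E : JointlySmooth E
  smooth_H : JointlySmooth H
  smooth_B : JointlySmooth B
  solves : ∀ x t, |x| + |t| < R → |t| ≤ τ → D.SolvesAt vt vx vy lam s E H B x t
  constraint : ∀ x, |x| < R → D.ConstraintAt E H x 0
  bound_E : ∀ x, |x| < R → ‖E x 0‖ ≤ M
  bound_H : ∀ x, |x| < R → ‖H x 0‖ ≤ M
  bound_B : ∀ x, |x| < R → ‖B x 0‖ ≤ M

namespace LocalSolution

theorem reflect (h : D.LocalSolution vt vx vy lam s R τ M E H B) {a b : ℝ}
    (ha : a = 1 ∨ a = -1) (hb : b = 1 ∨ b = -1) :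
    D.LocalSolution (a * vt) (b * vx) (a * b * vy) lam s R τ M (fun x t => a • E (a * x) (b * t))
      (fun x t => H (a * x) (b * t)) (fun x t => b • B (a * x) (b * t)) := by
  have ha' : |a| = 1 := by rcases ha with rfl | rfl <;> simp
  have hb' : |b| = 1 := by rcases hb with rfl | rfl <;> simp
  have hax : ∀ x, |a * x| = |x| := fun x => by rw [abs_mul, ha', one_mul]
  have hbt : ∀ t, |b * t| = |t| := fun t => by rw [abs_mul, hb', one_mul]
  refine ⟨h.smooth_E.reflect a b a, by simpa only [one_smul] using h.smooth_H.reflect a b 1,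
    h.smooth_B.reflect a b b, fun x t hR hτ => ?_, fun x hx => ?_, fun x hx => ?_, fun x hx => ?_,
    fun x hx => ?_⟩
  · exact (h.solves (a * x) (b * t) (by rwa [hax, hbt]) (by rwa [hbt])).reflect ha hb
      h.smooth_E h.smooth_H h.smooth_B
  · refine ConstraintAt.reflect h.smooth_H ?_
    rw [mul_zero]
    exact h.constraint _ (by rwa [hax])
  · simpa [norm_smul, ha'] using h.bound_E _ (by rwa [hax])
  · simpa using h.bound_H _ (by rwa [hax])
  · simpa [norm_smul, hb'] using h.bound_B _ (by rwa [hax])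

theorem constraintAt (h : D.LocalSolution vt vx vy lam s R τ M E H B) {x t : ℝ} (ht : 0 ≤ t)
    (hxt : |x| + t < R) (htτ : t ≤ τ) : D.ConstraintAt E H x t := by
  refine ConstraintAt.propagate (vt := vt) (vx := vx) (vy := vy) (lam := lam) (s := s)
    h.smooth_E h.smooth_H h.smooth_B ht (fun t' ht' => ?_)
    (h.constraint x (by linarith))
  have ho : IsOpen {x' : ℝ | |x'| + t' < R} := isOpen_lt (by fun_prop) continuous_const
  have hx : x ∈ {x' : ℝ | |x'| + t' < R} := by
    simp only [mem_ofPred_eq]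
    linarith [ht'.2]
  filter_upwards [ho.mem_nhds hx] with x' hx'
  exact h.solves x' t' (by rwa [abs_of_nonneg ht'.1])
    (by rw [abs_of_nonneg ht'.1]; exact ht'.2.trans htτ)

end LocalSolution

theorem abs_bilin_le {Z : Type*} [NormedAddCommGroup Z] [NormedSpace ℝ Z]
    (β : W →L[ℝ] Z →L[ℝ] ℝ) (X : W) (Y : Z) : |β X Y| ≤ ‖β‖ * ‖X‖ * ‖Y‖ := by
  rw [← Real.norm_eq_abs]
  exact β.le_opNorm₂ X Y

/-- The coefficient μ is a quarter of 2 λ vₜ up to sign, so the cross term consumes at most half of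
the quadratic part (X² + Z²)/2 of the energy. -/
theorem abs_smallness (hsmall : ∀ E H, |2 * lam * vt * D.p H E| ≤ D.g E E + D.g H H) (X Z : W) :
    |-(lam * vt / 2) * D.p Z X| ≤ 1 / 4 * (D.g X X + D.g Z Z) := by
  have h1 := hsmall X Z
  have h2 : -(lam * vt / 2) * D.p Z X = -(1 / 4) * (2 * lam * vt * D.p Z X) := by ring
  rw [h2, abs_mul, abs_neg, abs_of_nonneg (by norm_num : (0 : ℝ) ≤ 1 / 4)]
  linarith

/-- The failure of energy conservation for s ≠ 1 is quadratic, hence at most a multiple of the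
energy. -/
theorem source_le (s : ℝ) {c₀ e : ℝ} (hc₀ : 0 < c₀) {H B : W}
    (he : c₀ / 4 * (‖B‖ ^ 2 + ‖H‖ ^ 2) ≤ e) :
    (s - 1) * D.g B (D.br H D.R) ≤
      |s - 1| * (‖D.g‖ * (‖D.br‖ * ‖D.R‖)) * (4 / c₀) * e := by
  have h1 : |(s - 1) * D.g B (D.br H D.R)| ≤
      |s - 1| * (‖D.g‖ * ‖B‖ * (‖D.br‖ * ‖H‖ * ‖D.R‖)) := by
    rw [abs_mul]
    gcongr
    refine (abs_bilin_le _ _ _).trans ?_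
    gcongr
    exact D.br.le_opNorm₂ _ _
  have h3 : ‖B‖ * ‖H‖ ≤ 4 / c₀ * e := by
    rw [div_mul_eq_mul_div, le_div_iff₀ hc₀]
    nlinarith [mul_nonneg hc₀.le (sq_nonneg (‖B‖ - ‖H‖)),
      mul_nonneg hc₀.le (sq_nonneg ‖B‖), mul_nonneg hc₀.le (sq_nonneg ‖H‖)]
  calc _ ≤ |s - 1| * (‖D.g‖ * ‖B‖ * (‖D.br‖ * ‖H‖ * ‖D.R‖)) := (le_abs_self _).trans h1
    _ = |s - 1| * (‖D.g‖ * (‖D.br‖ * ‖D.R‖)) * (‖B‖ * ‖H‖) := by ring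
    _ ≤ |s - 1| * (‖D.g‖ * (‖D.br‖ * ‖D.R‖)) * (4 / c₀ * e) := by gcongr
    _ = _ := by ring

/-- The growth rate of `D.g X X` along a characteristic is controlled by the transverse flux. -/
theorem characteristic_growth_le (D : FrameAlgebra W) (s b : ℝ) {c₀ P : ℝ} (hc₀ : 0 < c₀)
    (hg : ∀ X, c₀ * ‖X‖ ^ 2 ≤ D.g X X) (X Y H : W) (hP : 1 / 4 * (D.g Y Y + D.g H H) ≤ P) :
    s * D.g X (D.br H D.R) + D.g (D.br X H) H - b * D.g X (D.q Y H) ≤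
      (|s| * (‖D.g‖ * (‖D.br‖ * ‖D.R‖)) + ‖D.g‖ * ‖D.br‖ + |b| * (‖D.g‖ * ‖D.q‖)) *
        ((1 + 1 / c₀) * (1 + 4 / c₀)) * ((1 + D.g X X) * (1 + P)) := by
  have t1 : s * D.g X (D.br H D.R) ≤ |s| * (‖D.g‖ * (‖D.br‖ * ‖D.R‖)) * (‖X‖ * ‖H‖) := by
    refine (le_abs_self _).trans ?_
    rw [abs_mul]
    have := (abs_bilin_le D.g X (D.br H D.R)).trans
      (mul_le_mul_of_nonneg_left (D.br.le_opNorm₂ H D.R) (by positivity))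
    calc |s| * |D.g X (D.br H D.R)| ≤ |s| * (‖D.g‖ * ‖X‖ * (‖D.br‖ * ‖H‖ * ‖D.R‖)) := by
          gcongr
      _ = _ := by ring
  have t2 : D.g (D.br X H) H ≤ ‖D.g‖ * ‖D.br‖ * (‖X‖ * ‖H‖ ^ 2) := by
    refine (le_abs_self _).trans ?_
    refine (abs_bilin_le D.g (D.br X H) H).trans ?_
    calc ‖D.g‖ * ‖D.br X H‖ * ‖H‖ ≤ ‖D.g‖ * (‖D.br‖ * ‖X‖ * ‖H‖) * ‖H‖ := by
          gcongr
          exact D.br.le_opNorm₂ _ _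
      _ = _ := by ring
  have t3 : -(b * D.g X (D.q Y H)) ≤ |b| * (‖D.g‖ * ‖D.q‖) * (‖X‖ * (‖Y‖ * ‖H‖)) := by
    refine (neg_le_abs _).trans ?_
    rw [abs_mul]
    have := (abs_bilin_le D.g X (D.q Y H)).trans
      (mul_le_mul_of_nonneg_left (D.q.le_opNorm₂ Y H) (by positivity))
    calc _ ≤ |b| * (‖D.g‖ * ‖X‖ * (‖D.q‖ * ‖Y‖ * ‖H‖)) := by
          gcongr
      _ = _ := by ring
  have s1 : ‖H‖ ≤ 1 + ‖H‖ ^ 2 + ‖Y‖ ^ 2 := by nlinarith [sq_nonneg (‖H‖ - 1), sq_nonneg ‖Y‖]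
  have s2 : ‖H‖ ^ 2 ≤ 1 + ‖H‖ ^ 2 + ‖Y‖ ^ 2 := by nlinarith [sq_nonneg ‖Y‖]
  have s3 : ‖Y‖ * ‖H‖ ≤ 1 + ‖H‖ ^ 2 + ‖Y‖ ^ 2 := by
    nlinarith [sq_nonneg (‖H‖ - ‖Y‖), sq_nonneg ‖H‖, sq_nonneg ‖Y‖]
  have hgX : 0 ≤ D.g X X := le_trans (by positivity) (hg X)
  have u1 : ‖X‖ ≤ (1 + 1 / c₀) * (1 + D.g X X) := by
    have h1 : ‖X‖ ^ 2 ≤ 1 / c₀ * D.g X X := by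
      rw [one_div, inv_mul_eq_div, le_div_iff₀ hc₀]
      linarith [hg X]
    have h3 : 0 < 1 / c₀ := by positivity
    nlinarith [sq_nonneg (‖X‖ - 1)]
  have u2 : 1 + ‖H‖ ^ 2 + ‖Y‖ ^ 2 ≤ (1 + 4 / c₀) * (1 + P) := by
    have h1 : c₀ / 4 * (‖H‖ ^ 2 + ‖Y‖ ^ 2) ≤ P := by linarith [hg Y, hg H]
    have h2 : ‖H‖ ^ 2 + ‖Y‖ ^ 2 ≤ 4 / c₀ * P := by
      rw [div_mul_eq_mul_div, le_div_iff₀ hc₀]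
      linarith
    have h3 : 0 < 4 / c₀ := by positivity
    have h4 : 0 ≤ P := le_trans (by positivity) h1
    nlinarith
  set S : ℝ := 1 + ‖H‖ ^ 2 + ‖Y‖ ^ 2 with hS
  have hS0 : 0 ≤ S := by positivity
  have h5 : 0 ≤ (1 + 1 / c₀) * (1 + D.g X X) := le_trans (norm_nonneg _) u1
  calc _ ≤ |s| * (‖D.g‖ * (‖D.br‖ * ‖D.R‖)) * (‖X‖ * ‖H‖) +
        ‖D.g‖ * ‖D.br‖ * (‖X‖ * ‖H‖ ^ 2) + |b| * (‖D.g‖ * ‖D.q‖) * (‖X‖ * (‖Y‖ * ‖H‖)) := by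
        linarith
    _ ≤ |s| * (‖D.g‖ * (‖D.br‖ * ‖D.R‖)) * (‖X‖ * S) +
        ‖D.g‖ * ‖D.br‖ * (‖X‖ * S) + |b| * (‖D.g‖ * ‖D.q‖) * (‖X‖ * S) := by
        gcongr
    _ = (|s| * (‖D.g‖ * (‖D.br‖ * ‖D.R‖)) + ‖D.g‖ * ‖D.br‖ + |b| * (‖D.g‖ * ‖D.q‖)) *
        (‖X‖ * S) := by ring
    _ ≤ (|s| * (‖D.g‖ * (‖D.br‖ * ‖D.R‖)) + ‖D.g‖ * ‖D.br‖ + |b| * (‖D.g‖ * ‖D.q‖)) *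
        (((1 + 1 / c₀) * (1 + D.g X X)) * ((1 + 4 / c₀) * (1 + P))) := by
        gcongr
    _ = _ := by ring

/-- The local conservation law for the energy. -/
theorem dt_energy_eq (hE : JointlySmooth E) (hH : JointlySmooth H) (hB : JointlySmooth B) {x t : ℝ}
    (hs : D.SolvesAt vt vx vy lam s E H B x t) (hcon : D.ConstraintAt E H x t) :
    dt (fun x t => D.energy (-(lam * vt / 2)) (E x t) (H x t) (B x t)) x t =
      dx (fun x t => D.flux (-(lam * vt / 2)) (E x t) (H x t) (B x t)) x t +
        (s - 1) * D.g (B x t) (D.br (H x t) D.R) := by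
  set μ : ℝ := -(lam * vt / 2) with hμ
  have dE := hE.hasDerivAt_dt x t
  have dH := hH.hasDerivAt_dt x t
  have dB := hB.hasDerivAt_dt x t
  have xE := hE.hasDerivAt_dx x t
  have xH := hH.hasDerivAt_dx x t
  have xB := hB.hasDerivAt_dx x t
  have e1 : dt (fun x t => D.energy μ (E x t) (H x t) (B x t)) x t = _ :=
    (((((dB.bilin dB D.g).add (dE.bilin dE D.g)).add (dH.bilin dH D.g)).const_mul (1 / 2)).add
      ((dH.bilin dE D.p).const_mul μ)).deriv
  have e2 : dx (fun x t => D.flux μ (E x t) (H x t) (B x t)) x t = _ :=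
    ((xE.bilin xB D.g).add ((xH.bilin xB D.p).const_mul μ)).deriv
  have key := energy_identity (D := D) (vx := vx) (vy := vy) (s := s) (E x t) (H x t) (B x t)
    (dx E x t) (dx H x t) (dx B x t) hcon hμ
  rw [← hs.eqE, ← hs.eqH, ← hs.eqB] at key
  have g1 := D.g_symm (dt B x t) (B x t)
  have g2 := D.g_symm (dt E x t) (E x t)
  have g3 := D.g_symm (dt H x t) (H x t)
  rw [e1, e2, g1, g2, g3]
  linarith

theorem jointlySmooth_energy (hE : JointlySmooth E) (hH : JointlySmooth H) (hB : JointlySmooth B)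
    (μ : ℝ) : JointlySmooth fun x t => D.energy μ (E x t) (H x t) (B x t) := by
  have h1 := hB.bilin hB D.g
  have h2 := hE.bilin hE D.g
  have h3 := hH.bilin hH D.g
  have h4 := hH.bilin hE D.p
  unfold JointlySmooth at h1 h2 h3 h4
  exact (contDiff_const.mul ((h1.add h2).add h3)).add (contDiff_const.mul h4)

theorem jointlySmooth_flux (hE : JointlySmooth E) (hH : JointlySmooth H) (hB : JointlySmooth B)
    (μ : ℝ) : JointlySmooth fun x t => D.flux μ (E x t) (H x t) (B x t) := by
  have h1 := hE.bilin hB D.g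
  have h4 := hH.bilin hB D.p
  unfold JointlySmooth at h1 h4
  exact h1.add (contDiff_const.mul h4)

theorem le_energy_sub_flux (hsmall : ∀ E H, |2 * lam * vt * D.p H E| ≤ D.g E E + D.g H H)
    (E H B : W) : 1 / 4 * (D.g (E - B) (E - B) + D.g H H) ≤
      D.energy (-(lam * vt / 2)) E H B - D.flux (-(lam * vt / 2)) E H B := by
  have h1 := neg_le_of_abs_le (abs_smallness hsmall (E - B) H)
  rw [energy_sub_flux]
  linarith

theorem energy_add_flux_nonneg (hsmall : ∀ E H, |2 * lam * vt * D.p H E| ≤ D.g E E + D.g H H)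
    (hg : ∀ X, 0 ≤ D.g X X) (E H B : W) :
    0 ≤ D.energy (-(lam * vt / 2)) E H B + D.flux (-(lam * vt / 2)) E H B := by
  have h1 := neg_le_of_abs_le (abs_smallness hsmall (E + B) H)
  rw [energy_add_flux]
  linarith [hg (E + B), hg H]

theorem le_energy (hsmall : ∀ E H, |2 * lam * vt * D.p H E| ≤ D.g E E + D.g H H) {c₀ : ℝ}
    (hc₀ : 0 < c₀) (hg : ∀ X, c₀ * ‖X‖ ^ 2 ≤ D.g X X) (E H B : W) :
    c₀ / 4 * (‖B‖ ^ 2 + ‖H‖ ^ 2) ≤ D.energy (-(lam * vt / 2)) E H B := by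
  have h1 := neg_le_of_abs_le (abs_smallness hsmall E H)
  have h2 := hg B
  have h3 := hg H
  have h4 : 0 ≤ D.g E E := le_trans (by positivity) (hg E)
  have h5 : 0 ≤ D.g B B := le_trans (by positivity) (hg B)
  simp only [energy]
  linarith

theorem energy_le (μ : ℝ) {E H B : W} (hE : ‖E‖ ≤ M) (hH : ‖H‖ ≤ M) (hB : ‖B‖ ≤ M) :
    D.energy μ E H B ≤ 3 / 2 * (‖D.g‖ * M * M) + |μ| * (‖D.p‖ * M * M) := by
  have hM : 0 ≤ M := (norm_nonneg _).trans hE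
  have n : ∀ (β : W →L[ℝ] W →L[ℝ] ℝ) X Y, ‖X‖ ≤ M → ‖Y‖ ≤ M → |β X Y| ≤ ‖β‖ * M * M := by
    intro β X Y hX hY
    refine (abs_bilin_le _ _ _).trans ?_
    gcongr
  have n1 := (le_abs_self _).trans (n D.g _ _ hE hE)
  have n2 := (le_abs_self _).trans (n D.g _ _ hH hH)
  have n3 := (le_abs_self _).trans (n D.g _ _ hB hB)
  have n4 : μ * D.p H E ≤ |μ| * (‖D.p‖ * M * M) := by
    refine (le_abs_self _).trans ?_
    rw [abs_mul]
    gcongr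
    exact n D.p _ _ hH hE
  simp only [energy]
  linarith

-- The backward triangle with vertex (x, T) gives an integral bound for the flux P through its right
-- side, and E + B is transported along that side with logarithmic growth rate at most C(1 + P). The
-- constant K is fixed before τ, so it does not depend on the lifespan; the continuity argument for
-- existence needs this.
set_option maxHeartbeats 1000000 in
theorem exists_bound_add (D : FrameAlgebra W) (vt vx vy lam s R M : ℝ)
    (hsmall : ∀ E H, |2 * lam * vt * D.p H E| ≤ D.g E E + D.g H H) :
    ∃ K, ∀ τ E H B, D.LocalSolution vt vx vy lam s R τ M E H B →
      ∀ x t, 0 ≤ t → |x| + t < R → t ≤ τ → ‖E x t + B x t‖ ≤ K := by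
  obtain ⟨c₀, hc₀, hg⟩ := D.g_pos
  set μ : ℝ := -(lam * vt / 2) with hμ
  have hgnn : ∀ X, 0 ≤ D.g X X := fun X => le_trans (by positivity) (hg X)
  set k₀ : ℝ := |s - 1| * (‖D.g‖ * (‖D.br‖ * ‖D.R‖)) with hk₀
  set k : ℝ := k₀ * (4 / c₀) with hk
  set M₁ : ℝ := 3 / 2 * (‖D.g‖ * M * M) + |μ| * (‖D.p‖ * M * M) with hM₁
  set Φ : ℝ := Real.exp (k * R) * (2 * R * M₁) with hΦ
  set a : ℝ := |s| * (‖D.g‖ * (‖D.br‖ * ‖D.R‖)) + ‖D.g‖ * ‖D.br‖ +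
    |lam * ((vx + vt) / 2)| * (‖D.g‖ * ‖D.q‖) with ha
  set C : ℝ := 2 * a * ((1 + 1 / c₀) * (1 + 4 / c₀)) with hC
  set Q : ℝ := (1 + ‖D.g‖ * (M + M) * (M + M)) * Real.exp (C * (R + Φ)) with hQ
  -- Q bounds g(X, X) at the vertex for X = E + B, and ‖X‖ ≤ 1 + ‖X‖².
  refine ⟨1 + Q / c₀, fun τ E H B h x T hT hxT hTτ => ?_⟩
  have hRT : T ≤ R := by linarith [abs_nonneg x]
  have hR0 : 0 ≤ R := hT.trans hRT
  have hM : 0 ≤ M := (norm_nonneg _).trans (h.bound_E x (by linarith))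
  have hk₀0 : 0 ≤ k₀ := by positivity
  have hk0 : 0 ≤ k := by positivity
  have hM₁0 : 0 ≤ M₁ := by positivity
  have ha0 : 0 ≤ a := by positivity
  have hC0 : 0 ≤ C := by positivity
  have htri : ∀ x' t, 0 ≤ t → |x' - x| ≤ T - t → |x'| + t < R ∧ t ≤ τ := by
    intro x' t ht hx'
    have h1 : |x'| ≤ |x' - x| + |x| := by simpa using abs_add_le (x' - x) x
    have h2 := abs_nonneg (x' - x)
    constructor <;> linarith
  have hsolve : ∀ x' t, 0 ≤ t → |x' - x| ≤ T - t → D.SolvesAt vt vx vy lam s E H B x' t := by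
    intro x' t ht hx'
    have := htri x' t ht hx'
    exact h.solves x' t (by rw [abs_of_nonneg ht]; exact this.1)
      (by rw [abs_of_nonneg ht]; exact this.2)
  have hcon : ∀ x' t, 0 ≤ t → |x' - x| ≤ T - t → D.ConstraintAt E H x' t := fun x' t ht hx' =>
    h.constraintAt ht (htri x' t ht hx').1 (htri x' t ht hx').2
  have hdata : ∀ x', |x' - x| ≤ T → |x'| < R := by
    intro x' hx'
    simpa using (htri x' 0 le_rfl (by simpa using hx')).1
  let e : ℝ → ℝ → ℝ := fun x t => D.energy μ (E x t) (H x t) (B x t)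
  let f : ℝ → ℝ → ℝ := fun x t => D.flux μ (E x t) (H x t) (B x t)
  have he : JointlySmooth e := jointlySmooth_energy h.smooth_E h.smooth_H h.smooth_B μ
  have hf : JointlySmooth f := jointlySmooth_flux h.smooth_E h.smooth_H h.smooth_B μ
  have hsub : ∀ x t, 1 / 4 * (D.g (E x t - B x t) (E x t - B x t) + D.g (H x t) (H x t)) ≤
      e x t - f x t := fun x t => le_energy_sub_flux hsmall _ _ _
  have hadd : ∀ x t, 0 ≤ e x t + f x t := fun x t => energy_add_flux_nonneg hsmall hgnn _ _ _
  have hlow : ∀ x t, c₀ / 4 * (‖B x t‖ ^ 2 + ‖H x t‖ ^ 2) ≤ e x t := fun x t =>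
    le_energy hsmall hc₀ hg _ _ _
  have hid : ∀ x' t, 0 ≤ t → |x' - x| ≤ T - t → dt e x' t ≤ dx f x' t + k * e x' t := by
    intro x' t ht hx'
    have h1 := dt_energy_eq h.smooth_E h.smooth_H h.smooth_B (hsolve x' t ht hx') (hcon x' t ht hx')
    have h2 := source_le (D := D) s hc₀ (hlow x' t)
    change dt e x' t = dx f x' t + _ at h1
    rw [h1]
    exact add_le_add_right h2 _
  have he0 : ∀ x', |x' - x| ≤ T → e x' 0 ≤ M₁ := by
    intro x' hx'
    have hx := hdata x' hx'
    exact energy_le μ (h.bound_E x' hx) (h.bound_H x' hx) (h.bound_B x' hx)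
  let P : ℝ → ℝ := fun t => e (x + (T - t)) t - f (x + (T - t)) t
  have hPΦ : ∫ t in (0 : ℝ)..T, P t ≤ Φ := by
    refine (integral_flux_le he hf hT hk0 hid (fun x' t _ _ => ?_) (fun x' t _ _ => hadd x' t)
      he0).trans ?_
    · exact le_trans (by have := hgnn (E x' t - B x' t); have := hgnn (H x' t); positivity)
        (hsub x' t)
    · rw [hΦ]
      gcongr
  have hPc : Continuous P := by
    have h1 := he.continuous.comp (f := fun t : ℝ => (x + (T - t), t)) (by fun_prop)
    have h2 := hf.continuous.comp (f := fun t : ℝ => (x + (T - t), t)) (by fun_prop)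
    exact h1.sub h2
  let X : ℝ → W := fun t => E (x + (T - t)) t + B (x + (T - t)) t
  let X' : ℝ → W := fun t =>
    ((-1 : ℝ) • dx E (x + (T - t)) t + (1 : ℝ) • dt E (x + (T - t)) t) +
    ((-1 : ℝ) • dx B (x + (T - t)) t + (1 : ℝ) • dt B (x + (T - t)) t)
  have hX : ∀ t, HasDerivAt X (X' t) t := by
    intro t
    have l : HasDerivAt (fun t => x + (T - t)) (-1) t :=
      ((hasDerivAt_id t).const_sub T).const_add x
    exact (h.smooth_E.hasDerivAt_comp l (hasDerivAt_id t)).add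
      (h.smooth_B.hasDerivAt_comp l (hasDerivAt_id t))
  have hq := fun t => (hX t).bilin (hX t) D.g
  -- X' is the derivative along the characteristic, so the equations for E and B cancel all
  -- x-derivatives and leave source - [B, E], to which `null_identity` applies.
  have hmain := one_add_le_exp_integral (C := C) hT hq hPc (by
    intro t ht
    have hx' : |x + (T - t) - x| ≤ T - t := by
      rw [add_sub_cancel_left, abs_of_nonneg (sub_nonneg.2 ht.2)]
    have hs := hsolve _ t ht.1 hx'
    have hX'eq : X' t = D.source vt vx vy lam s (E (x + (T - t)) t) (H (x + (T - t)) t)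
        (B (x + (T - t)) t) - D.br (B (x + (T - t)) t) (E (x + (T - t)) t) := by
      simp only [X']
      rw [hs.eqE, hs.eqB]
      simp only [neg_smul, one_smul]
      abel
    have hnull := null_identity (D := D) (vt := vt) (vx := vx) (vy := vy) (lam := lam) (s := s)
      (E (x + (T - t)) t) (H (x + (T - t)) t) (B (x + (T - t)) t)
    rw [← hX'eq] at hnull
    have hP1 := hsub (x + (T - t)) t
    change 1 / 4 * _ ≤ P t at hP1
    change D.g (X t) (X' t) = s * D.g (X t) _ + D.g (D.br (X t) _) _ - _ * D.g (X t) _ at hnull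
    have h1 := characteristic_growth_le D s (lam * ((vx + vt) / 2)) hc₀ hg (X t) _ _ hP1
    rw [D.g_symm (X' t) (X t), hnull, ← two_mul]
    refine (mul_le_mul_of_nonneg_left h1 zero_le_two).trans (le_of_eq ?_)
    rw [hC, ha]
    ring)
  have hX0 : D.g (X 0) (X 0) ≤ ‖D.g‖ * (M + M) * (M + M) := by
    have hx := hdata (x + (T - 0)) (by simp [abs_of_nonneg hT])
    have : ‖X 0‖ ≤ M + M := (norm_add_le _ _).trans (add_le_add (h.bound_E _ hx) (h.bound_B _ hx))
    refine (le_abs_self _).trans ((abs_bilin_le _ _ _).trans ?_)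
    gcongr
  have hXT : X T = E x T + B x T := by simp [X]
  have hfin : D.g (X T) (X T) ≤ Q := by
    have h1 : (1 + D.g (X 0) (X 0)) * Real.exp (C * (T + ∫ t in (0 : ℝ)..T, P t)) ≤ Q := by
      rw [hQ]
      have := hgnn (X 0)
      gcongr
    linarith
  rw [hXT] at hfin
  have h1 := (hg (E x T + B x T)).trans hfin
  have h2 : ‖E x T + B x T‖ ^ 2 ≤ Q / c₀ := by
    rw [le_div_iff₀ hc₀]
    linarith
  nlinarith [sq_nonneg (‖E x T + B x T‖ - 1)]

/-- A priori bound for the system on a double cone. -/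
theorem exists_apriori_bound (D : FrameAlgebra W) (vt vx vy lam s R M : ℝ)
    (hsmall : ∀ E H, |2 * lam * vt * D.p H E| ≤ D.g E E + D.g H H) :
    ∃ K, ∀ τ E H B, D.LocalSolution vt vx vy lam s R τ M E H B →
      ∀ x t, |x| + |t| < R → |t| ≤ τ → ‖E x t‖ ≤ K ∧ ‖H x t‖ ≤ K ∧ ‖B x t‖ ≤ K := by
  -- Smallness does not see the sign of vₜ, so it survives reflection.
  have hsmall' : ∀ a : ℝ, a = 1 ∨ a = -1 → ∀ E H, |2 * lam * (a * vt) * D.p H E| ≤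
      D.g E E + D.g H H := by
    rintro a (rfl | rfl) E H
    · simpa using hsmall E H
    · simpa [abs_mul] using hsmall E H
  have hK : ∃ K, ∀ a b : ℝ, (a = 1 ∨ a = -1) → (b = 1 ∨ b = -1) → ∀ τ E H B,
      D.LocalSolution (a * vt) (b * vx) (a * b * vy) lam s R τ M E H B →
      ∀ x t, 0 ≤ t → |x| + t < R → t ≤ τ → ‖E x t + B x t‖ ≤ K := by
    choose K hK using fun (a b : ℝ) (ha : a = 1 ∨ a = -1) =>
      exists_bound_add D (a * vt) (b * vx) (a * b * vy) lam s R M (hsmall' a ha)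
    refine ⟨max (max (K 1 1 (Or.inl rfl)) (K 1 (-1) (Or.inl rfl)))
      (max (K (-1) 1 (Or.inr rfl)) (K (-1) (-1) (Or.inr rfl))), ?_⟩
    intro a b ha hb τ E H B h x t h1 h2 h3
    have := hK a b ha τ E H B h x t h1 h2 h3
    rcases ha with rfl | rfl <;> rcases hb with rfl | rfl <;>
      simp only [le_max_iff] <;> tauto
  obtain ⟨K, hK⟩ := hK
  refine ⟨max K ((M + ‖D.R‖) * Real.exp (‖D.br‖ * K * R) + ‖D.R‖), ?_⟩
  intro τ E H B h x t hxt hτ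
  have hEB : ∀ x t, |x| + |t| < R → |t| ≤ τ → ‖E x t‖ ≤ K ∧ ‖B x t‖ ≤ K := by
    intro x t hxt hτ
    obtain ⟨b, hb, hbt⟩ : ∃ b : ℝ, (b = 1 ∨ b = -1) ∧ b * |t| = t := by
      rcases le_total 0 t with ht | ht
      · exact ⟨1, Or.inl rfl, by rw [abs_of_nonneg ht, one_mul]⟩
      · exact ⟨-1, Or.inr rfl, by rw [abs_of_nonpos ht]; ring⟩
    -- The reflection b makes the time nonnegative; the two values of a bound ±E + bB, and hence E
    -- and B.
    have hw : ∀ a : ℝ, a = 1 ∨ a = -1 → ‖a • E x t + b • B x t‖ ≤ K := by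
      intro a ha
      have ha2 : a * (a * x) = x := by rcases ha with rfl | rfl <;> ring
      have ha' : |a * x| = |x| := by rcases ha with rfl | rfl <;> simp
      have := hK a b ha hb τ _ _ _ (h.reflect ha hb) (a * x) |t| (abs_nonneg t) (by rwa [ha']) hτ
      simpa only [ha2, hbt] using this
    have w1 := hw 1 (Or.inl rfl)
    have w2 := hw (-1) (Or.inr rfl)
    have nb : ‖b • B x t‖ = ‖B x t‖ := by
      rw [norm_smul]; rcases hb with rfl | rfl <;> simp
    rw [one_smul] at w1
    rw [neg_smul, one_smul] at w2
    constructor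
    · have : (2 : ℝ) • E x t = (E x t + b • B x t) - (-E x t + b • B x t) := by
        rw [two_smul]; abel
      have h2 := norm_sub_le (E x t + b • B x t) (-E x t + b • B x t)
      rw [← this, norm_smul, Real.norm_ofNat] at h2
      linarith
    · have : (2 : ℝ) • (b • B x t) = (E x t + b • B x t) + (-E x t + b • B x t) := by
        rw [two_smul]; abel
      have h2 := norm_add_le (E x t + b • B x t) (-E x t + b • B x t)
      rw [← this, norm_smul, Real.norm_ofNat, nb] at h2
      linarith
  refine ⟨(hEB x t hxt hτ).1.trans (le_max_left _ _), ?_, (hEB x t hxt hτ).2.trans (le_max_left _ _)⟩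
  refine le_trans ?_ (le_max_right _ _)
  obtain ⟨b, hb, hbt⟩ : ∃ b : ℝ, (b = 1 ∨ b = -1) ∧ b * |t| = t := by
    rcases le_total 0 t with ht | ht
    · exact ⟨1, Or.inl rfl, by rw [abs_of_nonneg ht, one_mul]⟩
    · exact ⟨-1, Or.inr rfl, by rw [abs_of_nonpos ht]; ring⟩
  have hb' : |b| = 1 := by rcases hb with rfl | rfl <;> simp
  have hr := h.reflect (Or.inl rfl : (1 : ℝ) = 1 ∨ (1 : ℝ) = -1) hb
  have hK0 : 0 ≤ K := (norm_nonneg _).trans (hEB x t hxt hτ).1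
  have hmem : ∀ t' ∈ Icc 0 |t|, |x| + |t'| < R ∧ |t'| ≤ τ := by
    intro t' ht'
    rw [abs_of_nonneg ht'.1]
    exact ⟨by linarith [ht'.2], ht'.2.trans hτ⟩
  -- With B bounded, H - R satisfies a linear ODE at fixed x.
  let Z : ℝ → W := fun t' => H (1 * x) (b * t') - D.R
  have hZ : ∀ t' ∈ Icc 0 |t|, HasDerivAt Z (-D.br (b • B (1 * x) (b * t')) (Z t')) t' := by
    intro t' ht'
    have h1 := (hr.smooth_H.hasDerivAt_dt x t').sub_const D.R
    rwa [(hr.solves x t' (hmem t' ht').1 (hmem t' ht').2).eqH] at h1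
  have hgr := norm_le_gronwallBound_of_norm_deriv_right_le (f := Z)
    (f' := fun t' => -D.br (b • B (1 * x) (b * t')) (Z t')) (δ := M + ‖D.R‖) (K := ‖D.br‖ * K)
    (ε := 0) (a := 0) (b := |t|)
    (fun t' ht' => (hZ t' ht').continuousAt.continuousWithinAt)
    (fun t' ht' => (hZ t' (Ico_subset_Icc_self ht')).hasDerivWithinAt)
    (by
      refine (norm_sub_le _ _).trans (add_le_add_left ?_ _)
      simpa using h.bound_H x (by linarith [abs_nonneg t]))
    (fun t' ht' => by
      have ht2 := hmem t' (Ico_subset_Icc_self ht')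
      rw [norm_neg, add_zero]
      refine (D.br.le_opNorm₂ _ _).trans ?_
      gcongr
      rw [norm_smul, Real.norm_eq_abs, hb', one_mul, one_mul]
      exact (hEB x (b * t') (by rw [abs_mul, hb', one_mul]; exact ht2.1)
        (by rw [abs_mul, hb', one_mul]; exact ht2.2)).2) |t| ⟨abs_nonneg t, le_rfl⟩
  rw [gronwallBound_ε0, sub_zero] at hgr
  have hM : 0 ≤ M := (norm_nonneg _).trans (h.bound_E x (by linarith [abs_nonneg t]))
  have htR : |t| ≤ R := by linarith [abs_nonneg x]
  have e : H x t = Z |t| + D.R := by simp only [Z, hbt, one_mul, sub_add_cancel]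
  rw [e]
  refine (norm_add_le _ _).trans (add_le_add_left (hgr.trans ?_) _)
  gcongr

end FrameAlgebra

/-! ### Existence and uniqueness on cones and on the plane -/

/-- A smooth nonlinearity on a finite-dimensional space agrees on any ball with a smooth, globally
Lipschitz one. -/
theorem exists_lipschitz_truncation {V : Type*} [NormedAddCommGroup V] [NormedSpace ℝ V]
    [FiniteDimensional ℝ V] {F : V → V} (hF : ContDiff ℝ ∞ F) {M : ℝ} (hM : 0 < M) :
    ∃ F' : V → V, ContDiff ℝ ∞ F' ∧ (∃ L, 0 ≤ L ∧ ∀ a b, ‖F' a - F' b‖ ≤ L * ‖a - b‖) ∧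
      ∀ a, ‖a‖ ≤ M → F' a = F a := by
  let χ : ContDiffBump (0 : V) := ⟨M, M + 1, hM, by linarith⟩
  have hs : ContDiff ℝ ∞ fun a => χ a • F a := χ.contDiff.smul hF
  have hc : HasCompactSupport fun a => χ a • F a := χ.hasCompactSupport.smul_right
  obtain ⟨L, hL⟩ := hs.lipschitzWith_of_hasCompactSupport hc (by simp)
  refine ⟨_, hs, ⟨L, L.2, fun a b => ?_⟩, fun a ha => ?_⟩
  · simpa [dist_eq_norm] using hL.dist_le_mul a b
  · rw [χ.one_of_mem_closedBall (by simpa [χ] using ha), one_smul]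

namespace FrameAlgebra

variable {W : Type*} [NormedAddCommGroup W] [NormedSpace ℝ W] (D : FrameAlgebra W)
  (vt vx vy lam s : ℝ)

/-- The characteristic velocities of the components `E + B`, `E - B`, `H`. -/
def speeds : Fin 3 → ℝ := ![1, -1, 0]

/-- The characteristic components. -/
def encode (E H B : W) : Fin 3 → W := ![E + B, E - B, H]

noncomputable def decodeE (u : Fin 3 → W) : W := (1 / 2 : ℝ) • (u 0 + u 1)

noncomputable def decodeB (u : Fin 3 → W) : W := (1 / 2 : ℝ) • (u 0 - u 1)

/-- The nonlinearity of the system in the characteristic components. -/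
noncomputable def nonlinearity (u : Fin 3 → W) : Fin 3 → W :=
  ![D.source vt vx vy lam s (decodeE u) (u 2) (decodeB u) - D.br (decodeB u) (decodeE u),
    -D.source vt vx vy lam s (decodeE u) (u 2) (decodeB u) - D.br (decodeB u) (decodeE u),
    -D.br (decodeB u) (u 2 - D.R)]

theorem norm_speeds_le (j : Fin 3) : ‖speeds j‖ ≤ 1 := by
  fin_cases j <;> simp [speeds]

theorem contDiff_decodeE : ContDiff ℝ ∞ (decodeE : (Fin 3 → W) → W) :=
  contDiff_const.smul ((contDiff_apply ℝ W 0).add (contDiff_apply ℝ W 1))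

theorem contDiff_decodeB : ContDiff ℝ ∞ (decodeB : (Fin 3 → W) → W) :=
  contDiff_const.smul ((contDiff_apply ℝ W 0).sub (contDiff_apply ℝ W 1))

theorem decodeE_encode (E H B : W) : decodeE (encode E H B) = E := by
  simp only [decodeE, encode, Matrix.cons_val_zero, Matrix.cons_val_one]
  module

theorem decodeB_encode (E H B : W) : decodeB (encode E H B) = B := by
  simp only [decodeB, encode, Matrix.cons_val_zero, Matrix.cons_val_one]
  module

theorem encode_decode (u : Fin 3 → W) : encode (decodeE u) (u 2) (decodeB u) = u := by
  ext j
  fin_cases j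
  · change (1 / 2 : ℝ) • (u 0 + u 1) + (1 / 2 : ℝ) • (u 0 - u 1) = u 0
    module
  · change (1 / 2 : ℝ) • (u 0 + u 1) - (1 / 2 : ℝ) • (u 0 - u 1) = u 1
    module
  · rfl

omit [NormedSpace ℝ W] in
theorem norm_encode_le {E H B : W} {K : ℝ} (hE : ‖E‖ ≤ K) (hH : ‖H‖ ≤ K) (hB : ‖B‖ ≤ K) :
    ‖encode E H B‖ ≤ 2 * K := by
  have hK : 0 ≤ K := (norm_nonneg _).trans hE
  rw [pi_norm_le_iff_of_nonneg (by positivity)]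
  intro j
  fin_cases j
  · exact (norm_add_le _ _).trans (by linarith)
  · exact (norm_sub_le _ _).trans (by linarith)
  · exact hH.trans (by linarith)

theorem contDiff_nonlinearity : ContDiff ℝ ∞ (D.nonlinearity vt vx vy lam s) := by
  have hE := contDiff_decodeE (W := W)
  have hB := contDiff_decodeB (W := W)
  have hH : ContDiff ℝ ∞ fun u : Fin 3 → W => u 2 := contDiff_apply ℝ W 2
  have bil : ∀ (β : W →L[ℝ] W →L[ℝ] W) {X Y : (Fin 3 → W) → W}, ContDiff ℝ ∞ X → ContDiff ℝ ∞ Y →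
      ContDiff ℝ ∞ fun u => β (X u) (Y u) := fun β X Y hX hY => (β.contDiff.comp hX).clm_apply hY
  have hS : ContDiff ℝ ∞ fun u : Fin 3 → W =>
      D.source vt vx vy lam s (decodeE u) (u 2) (decodeB u) :=
    ((contDiff_const.smul (bil D.br hH contDiff_const)).sub
      (((bil D.cg hB hB).sub (bil D.cg hE hE)).sub (bil D.cg hH hH))).sub
      (contDiff_const.smul (((contDiff_const.smul (bil D.q hB hE)).sub
        (contDiff_const.smul (bil D.q hB hH))).add (contDiff_const.smul (bil D.q hE hH))))
  rw [contDiff_pi]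
  intro j
  fin_cases j
  · exact hS.sub (bil D.br hB hE)
  · exact hS.neg.sub (bil D.br hB hE)
  · exact (bil D.br hB (hH.sub contDiff_const)).neg

variable {D vt vx vy lam s}

theorem jointlySmooth_encode {E H B : ℝ → ℝ → W} (hE : JointlySmooth E) (hH : JointlySmooth H)
    (hB : JointlySmooth B) : JointlySmooth fun x t => encode (E x t) (H x t) (B x t) := by
  unfold JointlySmooth at *
  rw [contDiff_pi]
  intro j
  fin_cases j
  · exact hE.add hB
  · exact hE.sub hB
  · exact hH

theorem SolvesAt.encode {E H B : ℝ → ℝ → W} (hE : JointlySmooth E)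
    (hB : JointlySmooth B) {x t : ℝ} (h : D.SolvesAt vt vx vy lam s E H B x t) :
    SolvesTransportAt speeds (D.nonlinearity vt vx vy lam s)
      (fun x t => FrameAlgebra.encode (E x t) (H x t) (B x t)) x t := by
  have h1 := hE.hasDerivAt_dt x t
  have h2 := hB.hasDerivAt_dt x t
  have h3 := hE.hasDerivAt_dx x t
  have h4 := hB.hasDerivAt_dx x t
  intro j
  simp only [nonlinearity, decodeE_encode, decodeB_encode]
  fin_cases j
  · have a1 : deriv (fun t' => E x t' + B x t') t = _ := (h1.add h2).deriv
    have a2 : deriv (fun x' => E x' t + B x' t) x = _ := (h3.add h4).deriv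
    simp only [FrameAlgebra.encode, speeds, Fin.zero_eta, Matrix.cons_val_zero, a1, a2, h.eqE, h.eqB,
      Matrix.cons_val]
    module
  · have a1 : deriv (fun t' => E x t' - B x t') t = _ := (h1.sub h2).deriv
    have a2 : deriv (fun x' => E x' t - B x' t) x = _ := (h3.sub h4).deriv
    simp only [FrameAlgebra.encode, speeds, Fin.mk_one, Matrix.cons_val_one, Matrix.cons_val_zero,
      a1, a2, h.eqE, h.eqB, Matrix.cons_val]
    module
  · have a1 : deriv (fun t' => H x t') t = _ := h.eqH
    simp [FrameAlgebra.encode, speeds, a1]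

theorem solvesAt_decode {u : ℝ → ℝ → Fin 3 → W} (hu : JointlySmooth u) {x t : ℝ}
    {F : (Fin 3 → W) → Fin 3 → W} (h : SolvesTransportAt speeds F u x t)
    (hF : F (u x t) = D.nonlinearity vt vx vy lam s (u x t)) :
    D.SolvesAt vt vx vy lam s (fun x t => decodeE (u x t)) (fun x t => u x t 2)
      (fun x t => decodeB (u x t)) x t := by
  have h1 := fun j => hasDerivAt_pi.1 (hu.hasDerivAt_dt x t) j
  have h2 := fun j => hasDerivAt_pi.1 (hu.hasDerivAt_dx x t) j
  have h0 : ∀ j, dt u x t j =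
      speeds j • dx u x t j + D.nonlinearity vt vx vy lam s (u x t) j := by
    intro j
    rw [← (h1 j).deriv, ← (h2 j).deriv, h j, hF]
  have a1 : dt (fun x t => decodeE (u x t)) x t = _ :=
    (((h1 0).add (h1 1)).const_smul (1 / 2 : ℝ)).deriv
  have a2 : dx (fun x t => decodeE (u x t)) x t = _ :=
    (((h2 0).add (h2 1)).const_smul (1 / 2 : ℝ)).deriv
  have a3 : dt (fun x t => decodeB (u x t)) x t = _ :=
    (((h1 0).sub (h1 1)).const_smul (1 / 2 : ℝ)).deriv
  have a4 : dx (fun x t => decodeB (u x t)) x t = _ :=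
    (((h2 0).sub (h2 1)).const_smul (1 / 2 : ℝ)).deriv
  have a5 : dt (fun x t => u x t 2) x t = _ := (h1 2).deriv
  refine ⟨?_, ?_, ?_⟩
  · rw [a1, a4, h0, h0]
    simp only [nonlinearity, speeds, Matrix.cons_val]
    module
  · rw [a5, h0]
    simp [nonlinearity, speeds]
  · rw [a3, a2, h0, h0]
    simp only [nonlinearity, speeds, Matrix.cons_val]
    module

/-- Uniqueness on double cones. -/
theorem eqOn_doubleCone [FiniteDimensional ℝ W] {F : (Fin 3 → W) → Fin 3 → W}
    (hF : ContDiff ℝ ∞ F) {u v : ℝ → ℝ → Fin 3 → W} (hu : JointlySmooth u) (hv : JointlySmooth v)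
    {R : ℝ} (hsu : ∀ x t, (x, t) ∈ doubleCone ℝ 1 R → SolvesTransportAt speeds F u x t)
    (hsv : ∀ x t, (x, t) ∈ doubleCone ℝ 1 R → SolvesTransportAt speeds F v x t)
    (h₀ : ∀ x, u x 0 = v x 0) {x t : ℝ} (h : (x, t) ∈ doubleCone ℝ 1 R) : u x t = v x t := by
  have : CompleteSpace W := FiniteDimensional.complete ℝ W
  obtain ⟨M₁, hM₁⟩ := (isCompact_doubleCone (Y := ℝ) (R := R) one_pos).exists_bound_of_continuousOn
    hu.continuous.continuousOn
  obtain ⟨M₂, hM₂⟩ := (isCompact_doubleCone (Y := ℝ) (R := R) one_pos).exists_bound_of_continuousOn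
    hv.continuous.continuousOn
  -- Both solutions are bounded on the compact cone, so F is Lipschitz along their values.
  obtain ⟨F', -, ⟨L, hL, hLip⟩, hFF'⟩ := exists_lipschitz_truncation hF
    (M := max (max M₁ M₂) 1) (by positivity)
  refine eqOn_doubleCone_of_mild (G := fun _ _ => F) (u₀ := fun x => u x 0) one_pos hL
    norm_speeds_le (hF.continuous.comp (by fun_prop)) hu.continuous hv.continuous
    (fun x t hxt => ?_)
    (fun x t hxt => mild_of_solvesTransportAt hF.continuous hu.of_le_one norm_speeds_le hsu
      (fun x _ => rfl) x t hxt)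
    (fun x t hxt => mild_of_solvesTransportAt hF.continuous hv.of_le_one norm_speeds_le hsv
      (fun x _ => (h₀ x).symm) x t hxt) x t h
  rw [← hFF' _ ((hM₁ (x, t) hxt).trans ((le_max_left _ _).trans (le_max_left _ _))),
    ← hFF' _ ((hM₂ (x, t) hxt).trans ((le_max_right _ _).trans (le_max_left _ _)))]
  exact hLip _ _

/-- Existence on double cones. -/
theorem exists_solution_on_doubleCone [FiniteDimensional ℝ W] (D : FrameAlgebra W)
    (vt vx vy lam s : ℝ)
    (hsmall : ∀ E H, |2 * lam * vt * D.p H E| ≤ D.g E E + D.g H H) {E₀ H₀ B₀ : ℝ → W}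
    (hE₀ : ContDiff ℝ ∞ E₀) (hH₀ : ContDiff ℝ ∞ H₀) (hB₀ : ContDiff ℝ ∞ B₀)
    (hcon : ∀ x, deriv H₀ x = -D.br (E₀ x) (H₀ x - D.R)) {R : ℝ} (hR : 0 < R) :
    ∃ u : ℝ → ℝ → Fin 3 → W, JointlySmooth u ∧
      (∀ x t, (x, t) ∈ doubleCone ℝ 1 R →
        SolvesTransportAt speeds (D.nonlinearity vt vx vy lam s) u x t) ∧
      ∀ x, u x 0 = encode (E₀ x) (H₀ x) (B₀ x) := by
  have : CompleteSpace W := FiniteDimensional.complete ℝ W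
  obtain ⟨M₁, hM₁⟩ := (isCompact_Icc (a := -R) (b := R)).exists_bound_of_continuousOn
    hE₀.continuous.continuousOn
  obtain ⟨M₂, hM₂⟩ := (isCompact_Icc (a := -R) (b := R)).exists_bound_of_continuousOn
    hH₀.continuous.continuousOn
  obtain ⟨M₃, hM₃⟩ := (isCompact_Icc (a := -R) (b := R)).exists_bound_of_continuousOn
    hB₀.continuous.continuousOn
  set M := max (max M₁ M₂) (max M₃ 0) with hM
  have b1 : ∀ x, |x| ≤ R → ‖E₀ x‖ ≤ M := fun x hx => (hM₁ x (abs_le.1 hx)).trans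
    ((le_max_left _ _).trans (le_max_left _ _))
  have b2 : ∀ x, |x| ≤ R → ‖H₀ x‖ ≤ M := fun x hx => (hM₂ x (abs_le.1 hx)).trans
    ((le_max_right _ _).trans (le_max_left _ _))
  have b3 : ∀ x, |x| ≤ R → ‖B₀ x‖ ≤ M := fun x hx => (hM₃ x (abs_le.1 hx)).trans
    ((le_max_left _ _).trans (le_max_right _ _))
  have hM0 : 0 ≤ M := (le_max_right _ _).trans (le_max_right _ _)
  obtain ⟨K, hK⟩ := exists_apriori_bound D vt vx vy lam s R M hsmall
  -- Bounds K or M on E, H, B give at most 2 max(K, M) for the components E ± B, H. The extra 1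
  -- keeps the cutoff radius strictly above this.
  set N := 2 * max K M + 1 with hN
  have hmax : 0 ≤ max K M := le_max_of_le_right hM0
  have hN0 : 0 < N := by positivity
  have hFs := D.contDiff_nonlinearity vt vx vy lam s
  obtain ⟨F, hF, ⟨L, hL, hLip⟩, hFeq⟩ := exists_lipschitz_truncation hFs hN0
  have hu₀ : ContDiff ℝ ∞ fun x => encode (E₀ x) (H₀ x) (B₀ x) := by
    rw [contDiff_pi]
    intro j
    fin_cases j
    · exact hE₀.add hB₀
    · exact hE₀.sub hB₀
    · exact hH₀
  obtain ⟨u, huc, hmild⟩ := exists_mild (G := fun _ _ => F) (Y := ℝ) one_pos norm_speeds_le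
    (hF.continuous.comp (by fun_prop)) (fun _ => ⟨L, hL, fun _ _ _ a b => hLip a b⟩)
    hu₀.continuous
  have hu : JointlySmooth u := contDiff_of_mild hF hu₀ huc hmild
  have hpde : ∀ x t, SolvesTransportAt speeds F u x t :=
    SolvesTransportAt.of_mild hF.continuous hu.of_le_one hmild
  have hinit : ∀ x, u x 0 = encode (E₀ x) (H₀ x) (B₀ x) := by
    intro x
    rw [hmild]
    ext j
    simp [duhamel]
  -- Up to a time τ at which the cutoff is inactive, u solves the true system and obeys the a priori
  -- bound, which improves N to N - 1.
  have hloc : ∀ τ, (∀ x t, (x, t) ∈ doubleCone ℝ 1 R → |t| ≤ τ → ‖u x t‖ ≤ N) →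
      ∀ x t, |x| + |t| < R → |t| ≤ τ → ‖u x t‖ ≤ 2 * max K M := by
    intro τ hτ x t hxt htτ
    have hls : D.LocalSolution vt vx vy lam s R τ M (fun x t => decodeE (u x t))
        (fun x t => u x t 2) (fun x t => decodeB (u x t)) := by
      refine ⟨contDiff_decodeE.comp hu, contDiff_pi.1 hu 2, contDiff_decodeB.comp hu,
        fun x t hxt ht => ?_, fun x hx => ?_, fun x hx => ?_, fun x hx => ?_, fun x hx => ?_⟩
      · refine solvesAt_decode hu (hpde x t) (hFeq _ (hτ x t ?_ ht))
        simpa [doubleCone] using hxt.le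
      · simp only [ConstraintAt, dx, hinit, decodeE_encode]
        exact hcon x
      · rw [hinit, decodeE_encode]
        exact b1 x hx.le
      · rw [hinit]
        exact b2 x hx.le
      · rw [hinit, decodeB_encode]
        exact b3 x hx.le
    obtain ⟨k1, k2, k3⟩ := hK τ _ _ _ hls x t hxt htτ
    rw [← encode_decode (u x t)]
    exact norm_encode_le (k1.trans (le_max_left _ _)) (k2.trans (le_max_left _ _))
      (k3.trans (le_max_left _ _))
  -- Otherwise take a point of the cone with ‖u‖ ≥ N and |t| minimal. At earlier times the cutoff is
  -- inactive, and the improved bound passes to the limit and contradicts ‖u‖ ≥ N.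
  have hbound : ∀ z ∈ doubleCone ℝ 1 R, ‖u z.1 z.2‖ < N := by
    by_contra hcontra
    push Not at hcontra
    have hZ : IsCompact (doubleCone ℝ 1 R ∩ {z : ℝ × ℝ | N ≤ ‖u z.1 z.2‖}) :=
      (isCompact_doubleCone one_pos).inter_right (isClosed_le continuous_const huc.norm)
    obtain ⟨⟨x, t⟩, ⟨hz1, hz2⟩, hmin⟩ := hZ.exists_isMinOn hcontra
      (f := fun z : ℝ × ℝ => |z.2|) (by fun_prop)
    simp only [mem_ofPred_eq] at hz2
    have hxt : |x| + |t| ≤ R := by simpa [doubleCone] using hz1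
    have hle : ‖u x t‖ ≤ 2 * max K M := by
      rcases eq_or_ne t 0 with rfl | ht
      · have hx : |x| ≤ R := by simpa using hxt
        rw [hinit]
        exact norm_encode_le ((b1 x hx).trans (le_max_right _ _))
          ((b2 x hx).trans (le_max_right _ _)) ((b3 x hx).trans (le_max_right _ _))
      · have hlim : Tendsto (fun θ : ℝ => ‖u (θ * x) (θ * t)‖) (𝓝[<] 1) (𝓝 ‖u x t‖) := by
          have hc : Continuous fun θ : ℝ => ‖u (θ * x) (θ * t)‖ :=
            (huc.comp (f := fun θ : ℝ => (θ * x, θ * t)) (by fun_prop)).norm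
          simpa using (hc.tendsto 1).mono_left nhdsWithin_le_nhds
        refine le_of_tendsto hlim ?_
        filter_upwards [Ioo_mem_nhdsLT (zero_lt_one (α := ℝ))] with θ hθ
        have ht' : 0 < |t| := abs_pos.2 ht
        -- Scaling by θ < 1 places the point both at an earlier time and inside the open cone.
        refine hloc |θ * t| (fun x' t' hmem' ht' => ?_) _ _ ?_ le_rfl
        · by_contra hgt
          have := hmin (show (x', t') ∈ _ from ⟨hmem', (not_le.1 hgt).le⟩)
          simp only [mem_ofPred_eq] at this
          rw [abs_mul, abs_of_pos hθ.1] at ht'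
          nlinarith [hθ.2]
        · rw [abs_mul, abs_mul, abs_of_pos hθ.1, ← mul_add]
          nlinarith [hθ.1, hθ.2, abs_nonneg x]
    linarith
  refine ⟨u, hu, fun x t hxt j => ?_, hinit⟩
  rw [hpde x t j, hFeq _ (hbound (x, t) hxt).le]

/-- Global existence for the Cauchy problem on the line, with arbitrary smooth initial data. -/
theorem exists_global_solution [FiniteDimensional ℝ W] (D : FrameAlgebra W)
    (vt vx vy lam s : ℝ)
    (hsmall : ∀ E H, |2 * lam * vt * D.p H E| ≤ D.g E E + D.g H H) {E₀ H₀ B₀ : ℝ → W}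
    (hE₀ : ContDiff ℝ ∞ E₀) (hH₀ : ContDiff ℝ ∞ H₀) (hB₀ : ContDiff ℝ ∞ B₀)
    (hcon : ∀ x, deriv H₀ x = -D.br (E₀ x) (H₀ x - D.R)) :
    ∃ E H B : ℝ → ℝ → W, JointlySmooth E ∧ JointlySmooth H ∧ JointlySmooth B ∧
      (∀ x t, D.SolvesAt vt vx vy lam s E H B x t) ∧ (∀ x t, D.ConstraintAt E H x t) ∧
      (∀ x, E x 0 = E₀ x) ∧ (∀ x, H x 0 = H₀ x) ∧ ∀ x, B x 0 = B₀ x := by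
  choose v hv hvs hv₀ using fun n : ℕ => exists_solution_on_doubleCone D vt vx vy lam s hsmall
    hE₀ hH₀ hB₀ hcon (R := n + 1) (by positivity)
  -- The n-th solution lives on the cone of radius n + 1, so each point is interior to the cone used
  -- there, and u locally agrees with a single smooth function.
  let u : ℝ → ℝ → Fin 3 → W := fun x t => v ⌈|x| + |t|⌉₊ x t
  have huv : ∀ (n : ℕ) (x t : ℝ), |x| + |t| ≤ n + 1 → u x t = v n x t := by
    intro n x t hn
    set m := ⌈|x| + |t|⌉₊ with hm
    have hxm : |x| + |t| ≤ m := Nat.le_ceil _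
    have hsub : ∀ k : ℕ, min m n ≤ k → ∀ z, z ∈ doubleCone ℝ 1 ((min m n : ℕ) + 1 : ℝ) →
        z ∈ doubleCone ℝ 1 ((k : ℝ) + 1) := by
      intro k hk z hz
      have : ((min m n : ℕ) : ℝ) ≤ k := by exact_mod_cast hk
      simp only [doubleCone, mem_ofPred_eq] at hz ⊢
      linarith
    refine eqOn_doubleCone (D.contDiff_nonlinearity vt vx vy lam s) (hv m) (hv n)
      (R := (min m n : ℕ) + 1) (fun x t h => hvs m x t (hsub m (min_le_left _ _) _ h))
      (fun x t h => hvs n x t (hsub n (min_le_right _ _) _ h))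
      (fun x => by rw [hv₀, hv₀]) ?_
    simp only [doubleCone, mem_ofPred_eq, Real.norm_eq_abs, one_mul]
    rcases min_choice m n with h | h <;> rw [h] <;> linarith
  have hnhds : ∀ x t : ℝ, ∀ᶠ z : ℝ × ℝ in 𝓝 (x, t), u z.1 z.2 = v ⌈|x| + |t|⌉₊ z.1 z.2 := by
    intro x t
    have ho : IsOpen {z : ℝ × ℝ | |z.1| + |z.2| < (⌈|x| + |t|⌉₊ : ℝ) + 1} :=
      isOpen_lt (by fun_prop) continuous_const
    have hmem : (x, t) ∈ {z : ℝ × ℝ | |z.1| + |z.2| < (⌈|x| + |t|⌉₊ : ℝ) + 1} := by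
      have := Nat.le_ceil (|x| + |t|)
      simp only [mem_ofPred_eq]
      linarith
    filter_upwards [ho.mem_nhds hmem] with z hz
    exact huv _ _ _ hz.le
  have hu : JointlySmooth u := contDiff_iff_contDiffAt.2 fun z =>
    (ContDiff.contDiffAt (hv ⌈|z.1| + |z.2|⌉₊)).congr_of_eventuallyEq (hnhds z.1 z.2)
  have hus : ∀ x t, SolvesTransportAt speeds (D.nonlinearity vt vx vy lam s) u x t := by
    intro x t j
    have hxt : (x, t) ∈ doubleCone ℝ 1 ((⌈|x| + |t|⌉₊ : ℝ) + 1) := by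
      have := Nat.le_ceil (|x| + |t|)
      simp only [doubleCone, mem_ofPred_eq, Real.norm_eq_abs, one_mul]
      linarith
    have h1 : (fun t' => u x t' j) =ᶠ[𝓝 t] fun t' => v ⌈|x| + |t|⌉₊ x t' j := by
      have hc : Tendsto (fun t' => (x, t')) (𝓝 t) (𝓝 (x, t)) :=
        (Continuous.prodMk_right x).tendsto t
      filter_upwards [hc.eventually (hnhds x t)] with t' ht' using congrFun ht' j
    have h2 : (fun x' => u x' t j) =ᶠ[𝓝 x] fun x' => v ⌈|x| + |t|⌉₊ x' t j := by
      have hc : Tendsto (fun x' => (x', t)) (𝓝 x) (𝓝 (x, t)) :=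
        (Continuous.prodMk_left t).tendsto x
      filter_upwards [hc.eventually (hnhds x t)] with x' hx' using congrFun hx' j
    rw [h1.deriv_eq, h2.deriv_eq]
    exact hvs _ x t hxt j
  have hinit : ∀ x, u x 0 = encode (E₀ x) (H₀ x) (B₀ x) := fun x => hv₀ _ x
  have sE : JointlySmooth fun x t => decodeE (u x t) := contDiff_decodeE.comp hu
  have sH : JointlySmooth fun x t => u x t 2 := contDiff_pi.1 hu 2
  have sB : JointlySmooth fun x t => decodeB (u x t) := contDiff_decodeB.comp hu
  have hsol : ∀ x t, D.SolvesAt vt vx vy lam s (fun x t => decodeE (u x t)) (fun x t => u x t 2)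
      (fun x t => decodeB (u x t)) x t := fun x t => solvesAt_decode hu (hus x t) rfl
  have hcon0 : ∀ x, D.ConstraintAt (fun x t => decodeE (u x t)) (fun x t => u x t 2) x 0 := by
    intro x
    simp only [ConstraintAt, dx, hinit, decodeE_encode]
    exact hcon x
  refine ⟨_, _, _, sE, sH, sB, hsol, fun x t => ?_, fun x => ?_, fun x => ?_, fun x => ?_⟩
  -- Propagation of the constraint is stated for forward time; backward time follows by reflection.
  · obtain ⟨b, hb, hbt⟩ : ∃ b : ℝ, (b = 1 ∨ b = -1) ∧ b * |t| = t := by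
      rcases le_total 0 t with ht | ht
      · exact ⟨1, Or.inl rfl, by rw [abs_of_nonneg ht, one_mul]⟩
      · exact ⟨-1, Or.inr rfl, by rw [abs_of_nonpos ht]; ring⟩
    have h0 : D.ConstraintAt (fun x t => (1 : ℝ) • decodeE (u (1 * x) (b * t)))
        (fun x t => u (1 * x) (b * t) 2) x 0 :=
      ConstraintAt.reflect (E := fun x t => decodeE (u x t)) (H := fun x t => u x t 2) sH
        (by simpa only [mul_zero, one_mul] using hcon0 x)
    have h1 := ConstraintAt.propagate (D := D) (sE.reflect 1 b 1)
      (by simpa only [one_smul] using sH.reflect 1 b 1) (sB.reflect 1 b b) (abs_nonneg t) (x := x)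
      (fun t' _ => Eventually.of_forall fun x' =>
        (hsol (1 * x') (b * t')).reflect (Or.inl rfl) hb sE sH sB) h0
    simpa only [ConstraintAt, dx, one_mul, one_smul, hbt] using h1
  · simp only [hinit, decodeE_encode]
  · simp only [hinit]
    rfl
  · simp only [hinit, decodeB_encode]

/-- Uniqueness for the Cauchy problem on the line. -/
theorem eq_of_solvesAt [FiniteDimensional ℝ W] {E H B E' H' B' : ℝ → ℝ → W}
    (hE : JointlySmooth E) (hH : JointlySmooth H) (hB : JointlySmooth B)
    (hE' : JointlySmooth E') (hH' : JointlySmooth H') (hB' : JointlySmooth B')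
    (h : ∀ x t, D.SolvesAt vt vx vy lam s E H B x t)
    (h' : ∀ x t, D.SolvesAt vt vx vy lam s E' H' B' x t)
    (e₁ : ∀ x, E x 0 = E' x 0) (e₂ : ∀ x, H x 0 = H' x 0) (e₃ : ∀ x, B x 0 = B' x 0) (x t : ℝ) :
    E x t = E' x t ∧ H x t = H' x t ∧ B x t = B' x t := by
  have key := eqOn_doubleCone (D.contDiff_nonlinearity vt vx vy lam s)
    (jointlySmooth_encode hE hH hB) (jointlySmooth_encode hE' hH' hB')
    (fun x t _ => (h x t).encode hE hB) (fun x t _ => (h' x t).encode hE' hB')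
    (fun x => by rw [e₁, e₂, e₃]) (mem_doubleCone_self x t)
  refine ⟨?_, congrFun key 2, ?_⟩
  · simpa only [decodeE_encode] using congrArg decodeE key
  · simpa only [decodeB_encode] using congrArg decodeB key

end FrameAlgebra

/-! ### From index notation to bilinear maps -/

section Coordinates

variable {ι : Type*} [Fintype ι]

/-- `contract T` as a continuous bilinear map. -/
noncomputable def contractL (T : ι → ι → ι → ℝ) : (ι → ℝ) →L[ℝ] (ι → ℝ) →L[ℝ] (ι → ℝ) :=
  LinearMap.toContinuousBilinearMap (
    LinearMap.mk₂ ℝ (contract T)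
      (fun X X' Y => by
        ext a; simp only [contract, Pi.add_apply, mul_add, add_mul, Finset.sum_add_distrib])
      (fun r X Y => by
        ext a
        simp only [contract, Pi.smul_apply, smul_eq_mul, Finset.mul_sum]
        exact Finset.sum_congr rfl fun b _ => Finset.sum_congr rfl fun c _ => by ring)
      (fun X Y Y' => by
        ext a; simp only [contract, Pi.add_apply, mul_add, Finset.sum_add_distrib])
      (fun r X Y => by
        ext a
        simp only [contract, Pi.smul_apply, smul_eq_mul, Finset.mul_sum]
        exact Finset.sum_congr rfl fun b _ => Finset.sum_congr rfl fun c _ => by ring))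

@[simp] theorem contractL_apply (T : ι → ι → ι → ℝ) (X Y : ι → ℝ) :
    contractL T X Y = contract T X Y := rfl

/-- `pairing m` as a continuous bilinear map. -/
noncomputable def pairingL (m : Matrix ι ι ℝ) : (ι → ℝ) →L[ℝ] (ι → ℝ) →L[ℝ] ℝ :=
  LinearMap.toContinuousBilinearMap (
    LinearMap.mk₂ ℝ (pairing m)
      (fun X X' Y => by
        simp only [pairing, Pi.add_apply, mul_add, add_mul, Finset.sum_add_distrib])
      (fun r X Y => by
        simp only [pairing, Pi.smul_apply, smul_eq_mul, Finset.mul_sum]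
        exact Finset.sum_congr rfl fun b _ => Finset.sum_congr rfl fun c _ => by ring)
      (fun X Y Y' => by
        simp only [pairing, Pi.add_apply, mul_add, Finset.sum_add_distrib])
      (fun r X Y => by
        simp only [pairing, Pi.smul_apply, smul_eq_mul, Finset.mul_sum]
        exact Finset.sum_congr rfl fun b _ => Finset.sum_congr rfl fun c _ => by ring))

@[simp] theorem pairingL_apply (m : Matrix ι ι ℝ) (X Y : ι → ℝ) :
    pairingL m X Y = pairing m X Y := rfl

theorem commC_eq_contract (C : ι → ι → ι → ℝ) (X Y : ι → ℝ) :
    commC C X Y = contract (fun a b c => C b c a) X Y := rfl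

theorem pairing_eq_dotProduct (m : Matrix ι ι ℝ) (X Y : ι → ℝ) :
    pairing m X Y = X ⬝ᵥ m.mulVec Y := by
  simp only [pairing, dotProduct, Matrix.mulVec, Finset.mul_sum]
  exact Finset.sum_congr rfl fun a _ => Finset.sum_congr rfl fun b _ => by ring

theorem pairing_transpose (m : Matrix ι ι ℝ) (X Y : ι → ℝ) :
    pairing m.transpose X Y = pairing m Y X := by
  simp only [pairing, Matrix.transpose_apply]
  rw [Finset.sum_comm]
  exact Finset.sum_congr rfl fun a _ => Finset.sum_congr rfl fun b _ => by ring

theorem commC_structureConst {𝔤 : Type*} [LieRing 𝔤] [LieAlgebra ℝ 𝔤] (e : Module.Basis ι ℝ 𝔤)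
    (X Y : ι → ℝ) :
    commC (structureConst e) X Y = e.equivFun ⁅e.equivFun.symm X, e.equivFun.symm Y⁆ := by
  ext a
  rw [Module.Basis.equivFun_symm_apply, Module.Basis.equivFun_symm_apply, sum_lie_sum]
  simp only [commC, structureConst, lie_smul, smul_lie, map_sum, map_smul, Finset.sum_apply,
    Pi.smul_apply, smul_eq_mul, Module.Basis.equivFun_apply]
  exact Finset.sum_congr rfl fun b _ => Finset.sum_congr rfl fun c _ => by ring

theorem commC_skew {𝔤 : Type*} [LieRing 𝔤] [LieAlgebra ℝ 𝔤] (e : Module.Basis ι ℝ 𝔤)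
    (X Y : ι → ℝ) : commC (structureConst e) X Y = -commC (structureConst e) Y X := by
  rw [commC_structureConst, commC_structureConst, ← lie_skew, map_neg]

theorem commC_jacobi {𝔤 : Type*} [LieRing 𝔤] [LieAlgebra ℝ 𝔤] (e : Module.Basis ι ℝ 𝔤)
    (X Y Z : ι → ℝ) : commC (structureConst e) X (commC (structureConst e) Y Z) =
      commC (structureConst e) (commC (structureConst e) X Y) Z +
        commC (structureConst e) Y (commC (structureConst e) X Z) := by
  simp only [commC_structureConst, LinearEquiv.symm_apply_apply]
  rw [leibniz_lie, map_add]

/-- The constant is the minimum of the form on the unit sphere; homogeneity does the rest. -/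
theorem exists_pairing_pos {g : Matrix ι ι ℝ} (hg : g.PosDef) :
    ∃ c, 0 < c ∧ ∀ X : ι → ℝ, c * ‖X‖ ^ 2 ≤ pairing g X X := by
  have hpos : ∀ X : ι → ℝ, X ≠ 0 → 0 < pairing g X X := by
    intro X hX
    rw [pairing_eq_dotProduct]
    simpa using hg.dotProduct_mulVec_pos hX
  rcases isEmpty_or_nonempty ι with hι | hι
  · exact ⟨1, one_pos, fun X => by simp [Subsingleton.elim X 0, pairing]⟩
  have hne : (Metric.sphere (0 : ι → ℝ) 1).Nonempty := by
    refine ⟨fun _ => 1, ?_⟩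
    rw [mem_sphere_zero_iff_norm]
    simp
  have hcont : Continuous fun X : ι → ℝ => pairing g X X := by
    simp only [pairing]
    fun_prop
  obtain ⟨X₀, hX₀, hmin⟩ := (isCompact_sphere (0 : ι → ℝ) 1).exists_isMinOn hne
    hcont.continuousOn
  have hX₀0 : X₀ ≠ 0 := by
    rintro rfl
    simp at hX₀
  refine ⟨pairing g X₀ X₀, hpos X₀ hX₀0, fun X => ?_⟩
  rcases eq_or_ne X 0 with rfl | hX
  · simp [pairing]
  have hn : ‖X‖ ≠ 0 := norm_ne_zero_iff.2 hX
  have h1 : pairing g X₀ X₀ ≤ pairing g (‖X‖⁻¹ • X) (‖X‖⁻¹ • X) :=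
    hmin (by simp [norm_smul, hn])
  have h2 : pairing g (‖X‖⁻¹ • X) (‖X‖⁻¹ • X) = ‖X‖⁻¹ * (‖X‖⁻¹ * pairing g X X) := by
    rw [← pairingL_apply]
    simp
  rw [h2] at h1
  calc pairing g X₀ X₀ * ‖X‖ ^ 2 ≤ ‖X‖⁻¹ * (‖X‖⁻¹ * pairing g X X) * ‖X‖ ^ 2 := by gcongr
    _ = pairing g X X := by field_simp

variable [DecidableEq ι]

theorem pairing_mulVec_inv {g : Matrix ι ι ℝ} (hg : g.PosDef) (X w : ι → ℝ) :
    pairing g X (g⁻¹.mulVec w) = X ⬝ᵥ w := by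
  rw [pairing_eq_dotProduct, Matrix.mulVec_mulVec, Matrix.mul_nonsing_inv _ ((Matrix.isUnit_iff_isUnit_det _).1 hg.isUnit),
    Matrix.one_mulVec]

omit [DecidableEq ι] in
theorem dotProduct_contract (T : ι → ι → ι → ℝ) (X Y Z : ι → ℝ) :
    X ⬝ᵥ contract T Y Z = ∑ d, ∑ b, ∑ c, T d b c * X d * Y b * Z c := by
  simp only [dotProduct, contract, Finset.mul_sum]
  exact Finset.sum_congr rfl fun d _ => Finset.sum_congr rfl fun b _ =>
    Finset.sum_congr rfl fun c _ => by ring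

omit [DecidableEq ι] in
theorem dotProduct_contract_rotate (T : ι → ι → ι → ℝ) (X Y Z : ι → ℝ) :
    X ⬝ᵥ contract (fun d b c => T b c d) Y Z = Y ⬝ᵥ contract T Z X := by
  rw [dotProduct_contract, dotProduct_contract, Finset.sum_comm]
  refine Finset.sum_congr rfl fun b _ => ?_
  rw [Finset.sum_comm]
  exact Finset.sum_congr rfl fun c _ => Finset.sum_congr rfl fun d _ => by ring

omit [DecidableEq ι] in
theorem contract_swap (T : ι → ι → ι → ℝ) (Y Z : ι → ℝ) :
    contract (fun d b c => T d c b) Y Z = contract T Z Y := by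
  ext d
  simp only [contract]
  rw [Finset.sum_comm]
  exact Finset.sum_congr rfl fun c _ => Finset.sum_congr rfl fun b _ => by ring

theorem pairing_raisedC {g : Matrix ι ι ℝ} (hg : g.PosDef) (C : ι → ι → ι → ℝ) (X Y Z : ι → ℝ) :
    pairing g X (contract (raisedC C g) Y Z) = pairing g (commC C X Y) Z := by
  have h1 : contract (raisedC C g) Y Z =
      g⁻¹.mulVec (contract (fun d b c => ∑ e, C d b e * g e c) Y Z) := by
    ext a
    simp only [contract, raisedC, Matrix.mulVec, dotProduct, Finset.mul_sum, Finset.sum_mul]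
    rw [Finset.sum_congr rfl fun b _ => Finset.sum_comm]
    rw [Finset.sum_comm]
    refine Finset.sum_congr rfl fun d _ => Finset.sum_congr rfl fun b _ =>
      Finset.sum_congr rfl fun c _ => Finset.sum_congr rfl fun e _ => by ring
  have h2 : contract (fun d b c => ∑ e, C d b e * g e c) Y Z = contract C Y (g.mulVec Z) := by
    ext d
    simp only [contract, Matrix.mulVec, dotProduct, Finset.mul_sum, Finset.sum_mul]
    refine Finset.sum_congr rfl fun b _ => ?_
    rw [Finset.sum_comm]
    exact Finset.sum_congr rfl fun c _ => Finset.sum_congr rfl fun e _ => by ring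
  rw [h1, pairing_mulVec_inv hg, h2, pairing_eq_dotProduct, dotProduct_comm (commC C X Y)]
  exact (dotProduct_contract_rotate C (g.mulVec Z) X Y).symm

omit [DecidableEq ι] in
theorem dotProduct_contract_commC (p : Matrix ι ι ℝ) (C : ι → ι → ι → ℝ) (X Y Z : ι → ℝ) :
    X ⬝ᵥ contract (fun d b c => ∑ e, p e d * C b c e) Y Z = pairing p (commC C Y Z) X := by
  have h : contract (fun d b c => ∑ e, p e d * C b c e) Y Z =
      p.transpose.mulVec (commC C Y Z) := by
    ext d
    simp only [contract, commC, Matrix.mulVec, dotProduct, Finset.mul_sum, Finset.sum_mul,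
      Matrix.transpose_apply]
    rw [Finset.sum_congr rfl fun b _ => Finset.sum_comm, Finset.sum_comm]
    exact Finset.sum_congr rfl fun e _ => Finset.sum_congr rfl fun b _ =>
      Finset.sum_congr rfl fun c _ => by ring
  rw [h, ← pairing_eq_dotProduct, pairing_transpose]

/-- The metric cancels its inverse. Antisymmetrization contributes -3/2 · 1/6 = -1/4, each of the
three cyclic terms occurs twice because the bracket is skew, and skewness of p supplies the
remaining sign. -/
theorem pairing_torsionQ {g p : Matrix ι ι ℝ} (hg : g.PosDef) (hp : p.transpose = -p)
    {C : ι → ι → ι → ℝ} (hC : ∀ X Y, commC C X Y = -commC C Y X) (X Y Z : ι → ℝ) :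
    pairing g X (contract (torsionQ C g p) Y Z) =
      1 / 2 * (pairing p X (commC C Y Z) + pairing p Y (commC C Z X) +
        pairing p Z (commC C X Y)) := by
  set T : ι → ι → ι → ℝ := fun d b c => ∑ e, p e d * C b c e with hT
  have h1 : contract (torsionQ C g p) Y Z =
      g⁻¹.mulVec (contract (fun d b c => -(3 / 2) * antisymm₃ T d b c) Y Z) := by
    ext a
    simp only [contract, torsionQ, Matrix.mulVec, dotProduct, Finset.mul_sum, Finset.sum_mul]
    rw [Finset.sum_congr rfl fun b _ => Finset.sum_comm, Finset.sum_comm]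
    exact Finset.sum_congr rfl fun d _ => Finset.sum_congr rfl fun b _ =>
      Finset.sum_congr rfl fun c _ => by ring
  have hT' : ∀ X Y Z, X ⬝ᵥ contract T Y Z = -pairing p X (commC C Y Z) := by
    intro X Y Z
    rw [hT, dotProduct_contract_commC, ← pairing_transpose, hp, ← pairingL_apply, ← pairingL_apply]
    simp [pairing]
  let T' : ι → ι → ι → ℝ := fun d b c => T d c b
  have e1 : X ⬝ᵥ contract (fun d b c => T b c d) Y Z = Y ⬝ᵥ contract T Z X :=
    dotProduct_contract_rotate T X Y Z
  have e2 : X ⬝ᵥ contract (fun d b c => T c d b) Y Z = Z ⬝ᵥ contract T X Y :=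
    (dotProduct_contract_rotate (fun d b c => T b c d) X Y Z).trans
      (dotProduct_contract_rotate T Y Z X)
  have e3 : X ⬝ᵥ contract (fun d b c => T b d c) Y Z = Y ⬝ᵥ contract T X Z :=
    (dotProduct_contract_rotate T' X Y Z).trans (congrArg (Y ⬝ᵥ ·) (contract_swap T Z X))
  have e4 : X ⬝ᵥ contract (fun d b c => T c b d) Y Z = Z ⬝ᵥ contract T Y X :=
    (dotProduct_contract_rotate (fun d b c => T' b c d) X Y Z).trans
      ((dotProduct_contract_rotate T' Y Z X).trans (congrArg (Z ⬝ᵥ ·) (contract_swap T X Y)))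
  have e5 : X ⬝ᵥ contract T' Y Z = X ⬝ᵥ contract T Z Y :=
    congrArg (X ⬝ᵥ ·) (contract_swap T Y Z)
  have key : X ⬝ᵥ contract (fun d b c => -(3 / 2) * antisymm₃ T d b c) Y Z =
      -(1 / 4) * (X ⬝ᵥ contract T Y Z + X ⬝ᵥ contract (fun d b c => T b c d) Y Z +
        X ⬝ᵥ contract (fun d b c => T c d b) Y Z - X ⬝ᵥ contract (fun d b c => T b d c) Y Z -
        X ⬝ᵥ contract T' Y Z - X ⬝ᵥ contract (fun d b c => T c b d) Y Z) := by
    simp only [dotProduct_contract, antisymm₃, ← Finset.sum_add_distrib, ← Finset.sum_sub_distrib,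
      Finset.mul_sum]
    exact Finset.sum_congr rfl fun d _ => Finset.sum_congr rfl fun b _ =>
      Finset.sum_congr rfl fun c _ => by simp only [T']; ring
  have hn : ∀ X Y Z, pairing p X (commC C Y Z) = -pairing p X (commC C Z Y) := by
    intro X Y Z
    rw [hC, ← pairingL_apply, ← pairingL_apply, map_neg]
  rw [h1, pairing_mulVec_inv hg, key, e1, e2, e3, e4, e5]
  simp only [hT']
  rw [hn Y X Z, hn X Z Y, hn Z Y X]
  ring

omit [DecidableEq ι] in
theorem pairing_commC_right (m : Matrix ι ι ℝ) (C : ι → ι → ι → ℝ) (X Y R : ι → ℝ) :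
    pairing m X (commC C Y R) = ∑ a, ∑ b, (∑ e, ∑ c, m a e * C b c e * R c) * X a * Y b := by
  simp only [pairing, commC, Finset.mul_sum, Finset.sum_mul]
  refine Finset.sum_congr rfl fun a _ => ?_
  rw [Finset.sum_comm]
  refine Finset.sum_congr rfl fun b _ => Finset.sum_congr rfl fun e _ =>
    Finset.sum_congr rfl fun c _ => by ring

end Coordinates

/-! ### The Cauchy problem in a basis of the Lie algebra -/

section Cauchy

variable {𝔤 : Type*} [LieRing 𝔤] [LieAlgebra ℝ 𝔤] {ι : Type*} [Fintype ι] [DecidableEq ι]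

/-- The algebraic data of the reduced system in the coordinates of a basis. -/
noncomputable def frameAlgebra (e : Module.Basis ι ℝ 𝔤) (R : ι → ℝ) {g p : Matrix ι ι ℝ}
    (hg : g.PosDef) (hp : p.transpose = -p) (hgR : MetricInvariant (structureConst e) g R)
    (hpR : SkewInvariant (structureConst e) p R) : FrameAlgebra (ι → ℝ) where
  br := contractL fun a b c => structureConst e b c a
  g := pairingL g
  p := pairingL p
  cg := contractL (raisedC (structureConst e) g)
  q := contractL (torsionQ (structureConst e) g p)
  R := R
  br_skew := commC_skew e
  jacobi := commC_jacobi e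
  g_symm X Y := by
    have h : g.transpose = g := by simpa using hg.isHermitian.eq
    rw [pairingL_apply, pairingL_apply, ← pairing_transpose, h]
  p_skew X Y := by
    rw [pairingL_apply, pairingL_apply, ← pairing_transpose, hp]
    simp [pairing]
  g_pos := exists_pairing_pos hg
  g_cg := pairing_raisedC hg _
  g_q := pairing_torsionQ hg hp (commC_skew e)
  g_R X Y := by
    change pairing g X (commC _ Y R) = -pairing g Y (commC _ X R)
    rw [pairing_commC_right, pairing_commC_right, Finset.sum_comm, ← Finset.sum_neg_distrib]
    refine Finset.sum_congr rfl fun b _ => ?_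
    rw [← Finset.sum_neg_distrib]
    refine Finset.sum_congr rfl fun a _ => ?_
    rw [hgR a b]
    ring
  p_R X Y := by
    change pairing p X (commC _ Y R) = pairing p Y (commC _ X R)
    rw [pairing_commC_right, pairing_commC_right, Finset.sum_comm]
    refine Finset.sum_congr rfl fun b _ => Finset.sum_congr rfl fun a _ => ?_
    rw [hpR a b]
    ring

namespace JointlySmooth

variable {W : Type*} [NormedAddCommGroup W] [NormedSpace ℝ W] {f : ℝ → ℝ → W}

theorem translate (hf : JointlySmooth f) (a b : ℝ) : JointlySmooth fun x t => f (x + a) (t + b) :=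
  ContDiff.comp (f := fun z : ℝ × ℝ => (z.1 + a, z.2 + b)) hf (by fun_prop)

theorem dt_apply {κ : Type*} [Fintype κ] {f : ℝ → ℝ → κ → ℝ} (hf : JointlySmooth f) (x t : ℝ) (i : κ) :
    deriv (fun t' => f x t' i) t = _root_.dt f x t i :=
  (hasDerivAt_pi.1 (hf.hasDerivAt_dt x t) i).deriv

theorem dx_apply {κ : Type*} [Fintype κ] {f : ℝ → ℝ → κ → ℝ} (hf : JointlySmooth f) (x t : ℝ) (i : κ) :
    deriv (fun x' => f x' t i) x = _root_.dx f x t i :=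
  (hasDerivAt_pi.1 (hf.hasDerivAt_dx x t) i).deriv

end JointlySmooth

theorem FrameAlgebra.SolvesAt.translate {W : Type*} [NormedAddCommGroup W] [NormedSpace ℝ W]
    {D : FrameAlgebra W} {vt vx vy lam s : ℝ} {E H B : ℝ → ℝ → W} {x t a b : ℝ}
    (h : D.SolvesAt vt vx vy lam s E H B (x + a) (t + b)) :
    D.SolvesAt vt vx vy lam s (fun x t => E (x + a) (t + b)) (fun x t => H (x + a) (t + b))
      (fun x t => B (x + a) (t + b)) x t := by
  have d1 : ∀ f : ℝ → ℝ → W, dt (fun x t => f (x + a) (t + b)) x t = dt f (x + a) (t + b) :=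
    fun f => deriv_comp_add_const (fun t => f (x + a) t) b t
  have d2 : ∀ f : ℝ → ℝ → W, dx (fun x t => f (x + a) (t + b)) x t = dx f (x + a) (t + b) :=
    fun f => deriv_comp_add_const (fun x => f x (t + b)) a x
  refine ⟨?_, ?_, ?_⟩
  · rw [d1, d2, h.eqE]
  · rw [d1, h.eqH]
  · rw [d1, d2, h.eqB]

theorem solvesReducedSystem_iff (e : Module.Basis ι ℝ 𝔤) (R : ι → ℝ) {g p : Matrix ι ι ℝ}
    (hg : g.PosDef) (hp : p.transpose = -p) (hgR : MetricInvariant (structureConst e) g R)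
    (hpR : SkewInvariant (structureConst e) p R) {vt vx vy lam s : ℝ} {u : FrameFields ι}
    (hE : JointlySmooth u.E) (hH : JointlySmooth u.H) (hB : JointlySmooth u.B) :
    SolvesReducedSystem (structureConst e) g p R vt vx vy lam s u ↔
      (∀ x t, (frameAlgebra e R hg hp hgR hpR).SolvesAt vt vx vy lam s u.E u.H u.B x t) ∧
      ∀ x t, (frameAlgebra e R hg hp hgR hpR).ConstraintAt u.E u.H x t := by
  constructor
  · intro h
    refine ⟨fun x t => ⟨?_, ?_, ?_⟩, fun x t => ?_⟩
    · ext a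
      rw [← hE.dt_apply, h.evolution_E, hB.dx_apply]
      rfl
    · ext a
      rw [← hH.dt_apply, h.evolution_H]
      rfl
    · ext a
      rw [← hB.dt_apply, h.evolution_B, hE.dx_apply]
      simp only [FrameAlgebra.source, frameAlgebra, contractL_apply, Pi.add_apply, Pi.sub_apply,
        Pi.smul_apply, smul_eq_mul, ← commC_eq_contract]
      ring
    · unfold FrameAlgebra.ConstraintAt
      ext a
      rw [← hH.dx_apply, h.constraint t x a]
      rfl
  · rintro ⟨h, hc⟩
    refine ⟨fun t x a => ?_, fun x t a => ?_, fun x t a => ?_, fun x t a => ?_⟩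
    · rw [hH.dx_apply, hc x t]
      rfl
    · rw [hE.dt_apply, hB.dx_apply, (h x t).eqE]
      rfl
    · rw [hH.dt_apply, (h x t).eqH]
      rfl
    · rw [hB.dt_apply, hE.dx_apply, (h x t).eqB]
      simp only [FrameAlgebra.source, frameAlgebra, contractL_apply, Pi.add_apply, Pi.sub_apply,
        Pi.smul_apply, smul_eq_mul, ← commC_eq_contract]
      ring

omit [DecidableEq ι] in
theorem pairing_self_nonneg {g : Matrix ι ι ℝ} (hg : g.PosDef) (X : ι → ℝ) :
    0 ≤ pairing g X X := by
  obtain ⟨c, hc, h⟩ := exists_pairing_pos hg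
  exact le_trans (by positivity) (h X)

omit [DecidableEq ι] in
theorem exists_forall_isSmallCoupling {g p : Matrix ι ι ℝ} (hg : g.PosDef) (vt : ℝ) :
    ∃ lam₀ : ℝ, 0 < lam₀ ∧ ∀ lam : ℝ, |lam| < lam₀ → IsSmallCoupling g p vt lam := by
  obtain ⟨c, hc, h⟩ := exists_pairing_pos hg
  -- This threshold makes the cross term at most half of E² + H², so k = 2 works on both sides; the
  -- summand 1 avoids division by zero.
  refine ⟨c / (2 * (|vt| * ‖pairingL p‖ + 1)), by positivity, fun lam hlam => ⟨2, two_pos, ?_⟩⟩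
  intro E H
  rw [lt_div_iff₀ (by positivity)] at hlam
  have h1 : |2 * lam * vt * pairing p H E| ≤ 1 / 2 * (pairing g E E + pairing g H H) := by
    have h2 : |pairing p H E| ≤ ‖pairingL p‖ * ‖H‖ * ‖E‖ := FrameAlgebra.abs_bilin_le (pairingL p) H E
    calc |2 * lam * vt * pairing p H E| = 2 * |lam| * |vt| * |pairing p H E| := by
          simp only [abs_mul, abs_two]
      _ ≤ 2 * |lam| * |vt| * (‖pairingL p‖ * ‖H‖ * ‖E‖) := by gcongr
      _ = (|lam| * (2 * (|vt| * ‖pairingL p‖))) * (‖H‖ * ‖E‖) := by ring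
      _ ≤ c * (‖H‖ * ‖E‖) := by
          gcongr
          nlinarith [abs_nonneg lam]
      _ ≤ 1 / 2 * (c * ‖E‖ ^ 2 + c * ‖H‖ ^ 2) := by
          nlinarith [mul_nonneg hc.le (sq_nonneg (‖H‖ - ‖E‖))]
      _ ≤ _ := by
          have := h E
          have := h H
          linarith
  have h3 := abs_le.1 h1
  have h4 := pairing_self_nonneg hg E
  have h5 := pairing_self_nonneg hg H
  constructor <;> linarith [h3.1, h3.2]

-- The lower estimate makes the form nonnegative, and replacing H by -H reverses the sign of the
-- cross term. This is the form in which smallness enters the energy estimates.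
omit [DecidableEq ι] in
theorem IsSmallCoupling.abs_le {g p : Matrix ι ι ℝ} (hg : g.PosDef) {vt lam : ℝ}
    (h : IsSmallCoupling g p vt lam) (E H : ι → ℝ) :
    |2 * lam * vt * pairing p H E| ≤ pairing g E E + pairing g H H := by
  obtain ⟨k, hk, h⟩ := h
  have h1 := (h E H).1
  have h2 := (h E (-H)).1
  have e1 : pairing g (-H) (-H) = pairing g H H := by simp [pairing]
  have e2 : pairing p (-H) E = -pairing p H E := by simp [pairing]
  have h3 : 0 ≤ 1 / k * (pairing g E E + pairing g H H) :=
    mul_nonneg (by positivity) (add_nonneg (pairing_self_nonneg hg E) (pairing_self_nonneg hg H))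
  rw [e1, e2] at h2
  rw [_root_.abs_le]
  constructor <;> linarith

theorem JointlySmooth.isSmoothField_of_translate {κ : Type*} [Fintype κ] {f : ℝ → ℝ → κ → ℝ} (hf : JointlySmooth f)
    {S : Space} (hS : ∀ L hL, S = Space.circle L hL → ∀ x t, f (x + L) t = f x t) :
    S.IsSmoothField f where
  isFunctionOn t := by
    cases S with
    | line => trivial
    | circle L hL => exact fun x => hS L hL rfl x t
  smooth := hf

end Cauchy

end

theorem theorem4 {𝔤 : Type*} [LieRing 𝔤] [LieAlgebra ℝ 𝔤]
    {ι : Type*} [Fintype ι] [DecidableEq ι] (e : Module.Basis ι ℝ 𝔤)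
    (S : Space) (vt vx vy : ℝ) (R : ι → ℝ) (g p : Matrix ι ι ℝ)
    (hg : g.PosDef) (hp : p.transpose = -p)
    (hgR : MetricInvariant (structureConst e) g R)
    (hpR : SkewInvariant (structureConst e) p R)
    (s : ℝ) (hs : s = 1 ∨ s = -1) :
    (∃ lam₀ : ℝ, 0 < lam₀ ∧ ∀ lam : ℝ, |lam| < lam₀ → IsSmallCoupling g p vt lam) ∧
    ∀ lam : ℝ, IsSmallCoupling g p vt lam →
      ∀ (t₀ : ℝ) (E₀ H₀ B₀ : ℝ → ι → ℝ),
        S.IsSmoothDatum E₀ → S.IsSmoothDatum H₀ → S.IsSmoothDatum B₀ →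
        SatisfiesConstraint (structureConst e) R E₀ H₀ →
        ∃! u : FrameFields ι,
          IsGlobalSolution S (structureConst e) g p R vt vx vy lam s t₀ E₀ H₀ B₀ u := by
  refine ⟨exists_forall_isSmallCoupling hg vt, ?_⟩
  intro lam hlam t₀ E₀ H₀ B₀ hE₀ hH₀ hB₀ hcon
  set D := frameAlgebra e R hg hp hgR hpR with hD
  obtain ⟨E, H, B, sE, sH, sB, hsol, hcons, iE, iH, iB⟩ :=
    D.exists_global_solution vt vx vy lam s (hlam.abs_le hg) hE₀.smooth hH₀.smooth hB₀.smooth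
      (fun x => by
        ext a
        have h := hasDerivAt_pi.1 ((hH₀.smooth.differentiable (by simp)) x).hasDerivAt a
        rw [← h.deriv, hcon x a]
        rfl)
  -- On the circle the data are lifted to the line. The translate by L solves the same problem, so
  -- uniqueness makes the solution periodic.
  have hper : ∀ L hL, S = Space.circle L hL → ∀ x t,
      E (x + L) (t + 0) = E x t ∧ H (x + L) (t + 0) = H x t ∧ B (x + L) (t + 0) = B x t := by
    rintro L hL rfl x t
    exact FrameAlgebra.eq_of_solvesAt (sE.translate L 0) (sH.translate L 0) (sB.translate L 0)
      sE sH sB (fun x t => (hsol (x + L) (t + 0)).translate) hsol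
      (fun x => by rw [add_zero, iE, iE]; exact hE₀.isFunctionOn x)
      (fun x => by rw [add_zero, iH, iH]; exact hH₀.isFunctionOn x)
      (fun x => by rw [add_zero, iB, iB]; exact hB₀.isFunctionOn x) x t
  simp only [add_zero] at hper
  refine ⟨⟨fun x t => E (x + 0) (t + -t₀), fun x t => H (x + 0) (t + -t₀),
    fun x t => B (x + 0) (t + -t₀)⟩, ?_, ?_⟩
  · have sE' := sE.translate 0 (-t₀)
    have sH' := sH.translate 0 (-t₀)
    have sB' := sB.translate 0 (-t₀)
    refine ⟨sE'.isSmoothField_of_translate ?_, sH'.isSmoothField_of_translate ?_,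
      sB'.isSmoothField_of_translate ?_,
      (solvesReducedSystem_iff e R hg hp hgR hpR sE' sH' sB').2
        ⟨fun x t => (hsol (x + 0) (t + -t₀)).translate, fun x t => ?_⟩,
      fun x => ?_, fun x => ?_, fun x => ?_⟩
    · intro L hL h x t
      simpa using (hper L hL h x (t + -t₀)).1
    · intro L hL h x t
      simpa using (hper L hL h x (t + -t₀)).2.1
    · intro L hL h x t
      simpa using (hper L hL h x (t + -t₀)).2.2
    · simpa [FrameAlgebra.ConstraintAt, dx] using hcons x (t + -t₀)
    · simpa using iE x
    · simpa using iH x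
    · simpa using iB x
  · intro v hv
    have sE' : JointlySmooth v.E := hv.smooth_E.smooth
    have sH' : JointlySmooth v.H := hv.smooth_H.smooth
    have sB' : JointlySmooth v.B := hv.smooth_B.smooth
    have hv' := ((solvesReducedSystem_iff e R hg hp hgR hpR sE' sH' sB').1 hv.solves).1
    -- Any competitor, shifted so that its data sit at time 0, is compared with the constructed
    -- solution on the whole line.
    have key := FrameAlgebra.eq_of_solvesAt (sE'.translate 0 t₀) (sH'.translate 0 t₀)
      (sB'.translate 0 t₀) sE sH sB (fun x t => (hv' (x + 0) (t + t₀)).translate) hsol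
      (fun x => by simp [hv.initial_E, iE]) (fun x => by simp [hv.initial_H, iH])
      (fun x => by simp [hv.initial_B, iB])
    ext x t : 3
    · simpa using (key x (t + -t₀)).1
    · simpa using (key x (t + -t₀)).2.1
    · simpa using (key x (t + -t₀)).2.2
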